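/- **Setting.** Write $dA=d^2z/\pi$ for normalized Lebesgue measure on $\mathbb C$, $dV_k=dA^{\otimes k}$, and $\Delta=\partial\bar\partial$ (one quarter of the usual Laplacian). Let $Q:\mathbb C\to\mathbb R\cup\{+\infty\}$ be lower semicontinuous, finite on a set of positive logarithmic capacity, with $\liminf_{\zeta\to\infty}Q(\zeta)/\log|\zeta|>2$. Let $S$ be the droplet, i.e. the support of the equilibrium measure $\sigma$, the minimizer of $$I_Q[\mu]=\iint\log\frac1{|\zeta-\eta|}\,d\mu(\zeta)\,d\mu(\eta)+\int Q\,d\mu$$ among compactly supported Borel probability measures $\mu$ on $\mathbb C$. Assume that in some neighbourhood of $S$ the function $Q$ is (finite and) real analytic and $\Delta Q>0$. For $n\ge1$ let $\{\zeta_j\}_1^n$ be distributed according to the Boltzmann–Gibbs law $d\mathbb P_n=Z_n^{-1}e^{-H_n}\,dV_n$, where $H_n(\zeta)=\sum_{j\ne k}\log\frac1{|\zeta_j-\zeta_k|}+n\sum_jQ(\zeta_j)$. Let $\mathbf K_n$ be the reproducing kernel of the space of weighted polynomials $q\,e^{-nQ/2}$, $q$ a polynomial of degree at most $n-1$, regarded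 as a subspace of $L^2(\mathbb C,dA)$. Let $p_n\in S$ and $\theta_n\in\mathbb R$ be arbitrary sequences, consider the rescaled process $z_j=e^{-i\theta_n}\sqrt{n\Delta Q(p_n)}\,(\zeta_j-p_n)$, $1\le j\le n$, and put $$K_n(z,w)=\frac1{n\Delta Q(p_n)}\mathbf K_n(\zeta,\eta),\qquad z=e^{-i\theta_n}\sqrt{n\Delta Q(p_n)}\,(\zeta-p_n),\quad w=e^{-i\theta_n}\sqrt{n\Delta Q(p_n)}\,(\eta-p_n).$$ A continuous $f:\mathbb C^2\to\mathbb C$ is *Hermitian* if $f(z,w)=\overline{f(w,z)}$, and *Hermitian-entire* if moreover it is entire as a function of $z$ and $\bar w$. A *cocycle* is a Hermitian function $c$ with $c(z_1,z_2)c(z_2,z_3)\cdots c(z_k,z_1)=1$ for all $k\ge1$ and all $z_1,\dots,z_k\in\mathbb C$. Let $G(z,w)=e^{z\bar w-|z|^2/2-|w|^2/2}$ be the Ginibre kernel. **Theorem.** For each $n\ge1$, $K_n$ is a correlation kernel of the rescaled process, i.e. for every $k$ its $k$-point intensity with respect to $dV_k$ is $\det(K_n(z_i,z_j))_{i,j=1}^k$.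 Moreover there is a sequence $(c_n)$ of cocycles such that: 1. (Compactness) every subsequence of $(c_nK_n)$ has a further subsequence converging uniformly on compact subsets of $\mathbb C^2$; 2. (Analyticity) every limit $K$, uniform on compact subsets of $\mathbb C^2$, of a subsequence of $(c_nK_n)$ has the form $K=G\Psi$, where $\Psi$ is Hermitian-entire and satisfies the mass-one inequality $$\int_{\mathbb C}e^{-|z-w|^2}|\Psi(z,w)|^2\,dA(w)\le\Psi(z,z),\qquad z\in\mathbb C.$$ -/

import Mathlib

open MeasureTheory Filter Topology
open scoped ENNReal ComplexConjugate Laplacian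

noncomputable section

namespace RandomNormal

/-- Normalized Lebesgue measure `dA = d²z / π` on `ℂ`; the unit disc has measure `1`. -/
def dA : Measure ℂ := ENNReal.ofReal (Real.pi⁻¹) • volume

/-- The volume measure `dV_k = dA ⊗ ⋯ ⊗ dA` on `ℂ^k`. -/
def dV (k : ℕ) : Measure (Fin k → ℂ) := Measure.pi fun _ => dA

/-! ### Weighted potential theory and the droplet -/

/-- The integral of an extended-real function, as the integral of the positive part minus that of
the negative part. In what follows the negative part always has a finite integral. -/
def eintegral {X : Type*} [MeasurableSpace X] (μ : Measure X) (f : X → EReal) : EReal :=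
  ((∫⁻ x, (f x).toENNReal ∂μ : ℝ≥0∞) : EReal) - ((∫⁻ x, (-f x).toENNReal ∂μ : ℝ≥0∞) : EReal)

/-- `log (1 / |ζ - η|)`, equal to `+∞` if `ζ = η`. -/
def logKernel (ζ η : ℂ) : EReal := -ENNReal.log ‖ζ - η‖ₑ

/-- The logarithmic energy `∬ log (1 / |ζ - η|) dμ(ζ) dμ(η)`. -/
def logEnergy (μ : Measure ℂ) : EReal :=
  eintegral (μ.prod μ) fun x => logKernel x.1 x.2

/-- The weighted logarithmic energy `I_Q[μ]`. -/
def weightedEnergy (Q : ℂ → EReal) (μ : Measure ℂ) : EReal :=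
  logEnergy μ + eintegral μ Q

/-- A compactly supported Borel probability measure on `ℂ`. -/
def IsCompactProb (μ : Measure ℂ) : Prop :=
  IsProbabilityMeasure μ ∧ IsCompact μ.support

/-- `σ` minimizes the weighted energy among compactly supported Borel probability measures. -/
def IsEquilibriumMeasure (Q : ℂ → EReal) (σ : Measure ℂ) : Prop :=
  IsCompactProb σ ∧ ∀ μ : Measure ℂ, IsCompactProb μ → weightedEnergy Q σ ≤ weightedEnergy Q μ

open Classical in
/-- The equilibrium measure in the external field `Q`; for an admissible `Q` it exists and is
unique by Frostman's theorem (where there is no minimizer, this is the zero measure). -/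
def equilibriumMeasure (Q : ℂ → EReal) : Measure ℂ :=
  if h : ∃ σ, IsEquilibriumMeasure Q σ then h.choose else 0

/-- The droplet `S[Q]`, the support of the equilibrium measure. -/
def droplet (Q : ℂ → EReal) : Set ℂ := (equilibriumMeasure Q).support

/-- `E` has positive logarithmic capacity: some probability measure with compact support
contained in `E` has finite logarithmic energy. -/
def HasPositiveCapacity (E : Set ℂ) : Prop :=
  ∃ μ : Measure ℂ, IsCompactProb μ ∧ μ.support ⊆ E ∧ logEnergy μ < ⊤

/-- The standing assumptions on an external potential `Q : ℂ → ℝ ∪ {+∞}`. -/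
structure IsAdmissible (Q : ℂ → EReal) : Prop where
  ne_bot : ∀ z, Q z ≠ ⊥
  lsc : LowerSemicontinuous Q
  capacity : HasPositiveCapacity {z | Q z ≠ ⊤}
  growth : 2 < liminf (fun z : ℂ => Q z / (Real.log ‖z‖ : EReal)) (cocompact ℂ)

/-- The normalized Laplacian `ΔQ = ∂∂̄Q`, a quarter of the usual Laplacian, at points near which
`Q` is finite and smooth. -/
def lap (Q : ℂ → EReal) (z : ℂ) : ℝ := (1 / 4) * (Δ (fun ζ : ℂ => (Q ζ).toReal)) z

/-! ### The eigenvalue process -/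

/-- The energy `H_n(ζ) = ∑_{j ≠ k} log (1 / |ζ_j - ζ_k|) + n ∑_j Q(ζ_j)`. -/
def hamiltonian (Q : ℂ → EReal) (n : ℕ) (ζ : Fin n → ℂ) : EReal :=
  (∑ j, ∑ k with k ≠ j, logKernel (ζ j) (ζ k)) + (n : EReal) * ∑ j, Q (ζ j)

/-- The unnormalized Boltzmann-Gibbs measure `e^{-H_n} dV_n`. -/
def gibbsWeight (Q : ℂ → EReal) (n : ℕ) : Measure (Fin n → ℂ) :=
  (dV n).withDensity fun ζ => EReal.exp (-hamiltonian Q n ζ)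

/-- The Boltzmann-Gibbs law `ℙ_n = Z_n⁻¹ e^{-H_n} dV_n`. -/
def gibbs (Q : ℂ → EReal) (n : ℕ) : Measure (Fin n → ℂ) :=
  (gibbsWeight Q n Set.univ)⁻¹ • gibbsWeight Q n

/-- The magnification factor `√(n ΔQ(p))`. -/
def scale (Q : ℂ → EReal) (n : ℕ) (p : ℂ) : ℝ := Real.sqrt (n * lap Q p)

/-- The law of the rescaled system `z_j = e^{-iθ} √(n ΔQ(p)) (ζ_j - p)`. -/
def rescaledGibbs (Q : ℂ → EReal) (n : ℕ) (p : ℂ) (θ : ℝ) : Measure (Fin n → ℂ) :=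
  (gibbs Q n).map fun ζ j => Complex.exp (-(θ * Complex.I)) * (scale Q n p : ℂ) * (ζ j - p)

/-- `K` is a (Hermitian) correlation kernel of the `n`-point process whose law is `P`: for all `k`,
the `k`-point intensity of the process with respect to `dV_k` is `det (K(z_i, z_j))`. -/
def IsCorrelationKernel {n : ℕ} (P : Measure (Fin n → ℂ)) (K : ℂ → ℂ → ℂ) : Prop :=
  (∀ z w, K z w = conj (K w z)) ∧
  ∀ k : ℕ,
    (∀ z : Fin k → ℂ, 0 ≤ (Matrix.det (Matrix.of fun i j => K (z i) (z j))).re) ∧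
    ∀ f : (Fin k → ℂ) → ℝ≥0∞, Measurable f →
      ∫⁻ ζ, ∑ e : Fin k ↪ Fin n, f (fun i => ζ (e i)) ∂P =
        ∫⁻ z, f z * ENNReal.ofReal (Matrix.det (Matrix.of fun i j => K (z i) (z j))).re ∂(dV k)

/-! ### Weighted polynomials and their reproducing kernel -/

open Classical in
/-- The function `e^{-nQ/2}`, equal to `0` where `Q = +∞`. -/
def weight (Q : ℂ → EReal) (n : ℕ) (ζ : ℂ) : ℝ :=
  if Q ζ = ⊤ then 0 else Real.exp (-(n * (Q ζ).toReal) / 2)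

/-- Weighted polynomials of order `n`: the functions `q e^{-nQ/2}` with `q` a polynomial of degree
at most `n - 1`. -/
def IsWeightedPoly (Q : ℂ → EReal) (n : ℕ) (f : ℂ → ℂ) : Prop :=
  ∃ q : Polynomial ℂ, q.degree < n ∧ ∀ ζ, f ζ = q.eval ζ * (weight Q n ζ : ℂ)

/-- `K` is the reproducing kernel of the space of weighted polynomials of order `n`, regarded as a
subspace of `L²(ℂ, dA)`. -/
def IsReproducingKernel (Q : ℂ → EReal) (n : ℕ) (K : ℂ → ℂ → ℂ) : Prop :=
  (∀ η, IsWeightedPoly Q n fun ζ => K ζ η) ∧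
  ∀ f, IsWeightedPoly Q n f → ∀ η, f η = ∫ ζ, f ζ * conj (K ζ η) ∂dA

/-- A reproducing kernel is Hermitian and unique. -/
theorem IsReproducingKernel.eq_conj {Q : ℂ → EReal} {n : ℕ} {K L : ℂ → ℂ → ℂ}
    (hK : IsReproducingKernel Q n K) (hL : IsReproducingKernel Q n L) (z w : ℂ) :
    K z w = conj (L w z) := by
  rw [hK.2 _ (hL.1 z) w, hL.2 _ (hK.1 w) z, ← integral_conj]
  congr 1
  ext ζ
  simp [mul_comm]

theorem IsReproducingKernel.unique {Q : ℂ → EReal} {n : ℕ} {K L : ℂ → ℂ → ℂ}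
    (hK : IsReproducingKernel Q n K) (hL : IsReproducingKernel Q n L) : K = L := by
  ext z w
  rw [hK.eq_conj hL, ← hL.eq_conj hL]

open Classical in
/-- The reproducing kernel `𝐊_n` of the space of weighted polynomials of order `n`
(zero if there is none). -/
def kernel (Q : ℂ → EReal) (n : ℕ) : ℂ → ℂ → ℂ :=
  if h : ∃ K, IsReproducingKernel Q n K then h.choose else 0

/-- The rescaled kernel `K_n(z, w) = 𝐊_n(ζ, η) / (n ΔQ(p))`, where
`z = e^{-iθ} √(n ΔQ(p)) (ζ - p)` and `w = e^{-iθ} √(n ΔQ(p)) (η - p)`. -/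
def rescaledKernel (Q : ℂ → EReal) (n : ℕ) (p : ℂ) (θ : ℝ) (z w : ℂ) : ℂ :=
  kernel Q n (p + Complex.exp (θ * Complex.I) * z / (scale Q n p : ℂ))
      (p + Complex.exp (θ * Complex.I) * w / (scale Q n p : ℂ)) / ((n * lap Q p : ℝ) : ℂ)

/-! ### Hermitian functions, cocycles and the Ginibre kernel -/

/-- A continuous function with `f(z, w) = conj f(w, z)`. -/
def IsHermitianFun (f : ℂ → ℂ → ℂ) : Prop :=
  Continuous (fun x : ℂ × ℂ => f x.1 x.2) ∧ ∀ z w, f z w = conj (f w z)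

/-- A Hermitian function that is entire as a function of `z` and `w̄`. -/
def IsHermitianEntire (f : ℂ → ℂ → ℂ) : Prop :=
  IsHermitianFun f ∧ Differentiable ℂ fun x : ℂ × ℂ => f x.1 (conj x.2)

/-- A cocycle: a Hermitian function with `c(z_1, z_2) c(z_2, z_3) ⋯ c(z_k, z_1) = 1` for all
`k ≥ 1` and all `z_1, …, z_k` (here `k = m + 1`, and `i + 1` is taken modulo `m + 1`). -/
def IsCocycle (c : ℂ → ℂ → ℂ) : Prop :=
  IsHermitianFun c ∧ ∀ (m : ℕ) (z : Fin (m + 1) → ℂ), ∏ i, c (z i) (z (i + 1)) = 1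

/-- The Ginibre kernel. -/
def ginibre (z w : ℂ) : ℂ :=
  Complex.exp (z * conj w - (‖z‖ ^ 2 / 2 : ℝ) - (‖w‖ ^ 2 / 2 : ℝ))

/-- The mass-one inequality `∫ e^{-|z-w|²} |Ψ(z, w)|² dA(w) ≤ Ψ(z, z)` at every `z`, including the
finiteness of the integral. -/
def MassOneInequality (Ψ : ℂ → ℂ → ℂ) : Prop :=
  ∀ z, Integrable (fun w => Real.exp (-‖z - w‖ ^ 2) * ‖Ψ z w‖ ^ 2) dA ∧
    ∫ w, Real.exp (-‖z - w‖ ^ 2) * ‖Ψ z w‖ ^ 2 ∂dA ≤ (Ψ z z).re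

/-- Uniform convergence on compact subsets of `ℂ²`. -/
def TendstoOnCompacts (F : ℕ → ℂ → ℂ → ℂ) (K : ℂ → ℂ → ℂ) : Prop :=
  ∀ C : Set (ℂ × ℂ), IsCompact C →
    TendstoUniformlyOn (fun j (x : ℂ × ℂ) => F j x.1 x.2) (fun x => K x.1 x.2) atTop C

end RandomNormal

end

/-! The determinantal structure is algebra. The matrix of weighted monomials at `n` points has
determinant Vandermonde times weights, so `e^{-H_n}` equals `det 𝐊_n` up to the Gram determinant
(`det_kernelMatrix_gramKernel`). A self-reproducing kernel of trace `n` allows variables to be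
integrated out one at a time, which gives every intensity
(`IsProjectionKernel.lintegral_sum_embedding`). An affine change of variables carries this to the
rescaled process.

For the limits, expand `Q` to second order at `p_n`. Besides `Q(p_n)` and `ΔQ(p_n)|h|²`, the
expansion contains only the real part of a holomorphic polynomial. Its exponential is a holomorphic
function times a unimodular phase. The phase is absorbed in the cocycle, and `c_n K_n(z,w) =
L_n(z,w) E_n(z) E_n(w)` with `L_n` entire in `z` and `w̄` and `E_n → e^{-|z|²/2}` locally uniformly;
compactness of the droplet makes this uniform in the base point (`tendsto_localWeight`).

No prior estimate of the kernel is needed. The sub-mean value inequality for `L_n(·,w)` and the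
identity `∫|K_n(w,u)|² dA(u) = K_n(w,w)` give `|L_n(z,w)|² ≤ A |L_n(w,w)|` on compact sets. Taking
`z = w` bounds the diagonal by `A`, hence `L_n` everywhere by `A`. Montel's theorem then yields
compactness. Every limit is an entire function of `(z, w̄)` times `e^{-|z|²/2-|w|²/2}`, which is `G
Ψ`, and Fatou's lemma turns the mass identity into the mass-one inequality. -/

noncomputable section

namespace RandomNormal

open scoped ComplexOrder

/-! ### Determinantal identities -/

/-- Expansion of a determinant along its first row and first column. -/
theorem det_bordered {R : Type*} [CommRing R] {k : ℕ} (M : Matrix (Fin (k + 1)) (Fin (k + 1)) R) :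
    M.det = M 0 0 * (M.submatrix Fin.succ Fin.succ).det -
      ∑ i, ∑ j, M 0 (Fin.succ j) * (M.submatrix Fin.succ Fin.succ).adjugate j i *
        M (Fin.succ i) 0 := by
  rcases k with _ | k
  · simp
  rw [Matrix.det_succ_row_zero, Fin.sum_univ_succ, sub_eq_add_neg]
  congr 1
  · simp
  rw [Finset.sum_comm, ← Finset.sum_neg_distrib]
  refine Finset.sum_congr rfl fun j _ => ?_
  rw [Matrix.det_succ_column_zero, Finset.mul_sum, ← Finset.sum_neg_distrib]
  refine Finset.sum_congr rfl fun i _ => ?_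
  rw [Matrix.adjugate_fin_succ_eq_det_submatrix]
  have h1 : (M.submatrix Fin.succ (Fin.succ j).succAbove).submatrix i.succAbove Fin.succ =
      (M.submatrix Fin.succ Fin.succ).submatrix i.succAbove j.succAbove := by
    ext a b
    simp
  rw [h1]
  simp only [Fin.val_succ, Matrix.submatrix_apply, Fin.succ_succAbove_zero]
  ring

/-- The Gram-type matrix `(K(z_i, z_j))`. -/
def kernelMatrix {X : Type*} (K : X → X → ℂ) {k : ℕ} (z : Fin k → X) : Matrix (Fin k) (Fin k) ℂ :=
  Matrix.of fun i j => K (z i) (z j)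

section Determinantal

variable {X : Type*} [MeasurableSpace X] {ν : Measure X} {K : X → X → ℂ} {n : ℕ}

/-- A self-reproducing kernel of trace `n`. -/
structure IsProjectionKernel (ν : Measure X) (K : X → X → ℂ) (n : ℕ) : Prop where
  meas : Measurable fun x : X × X => K x.1 x.2
  nonneg : ∀ (k : ℕ) (z : Fin k → X), 0 ≤ (kernelMatrix K z).det.re
  integrable : ∀ x y, Integrable (fun u => K x u * K u y) ν
  reproducing : ∀ x y, ∫ u, K x u * K u y ∂ν = K x y
  integrable_diag : Integrable (fun u => K u u) ν
  trace : ∫ u, K u u ∂ν = n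

/-- In the bordered expansion the diagonal term integrates to `n det A` by the trace condition. By
the reproducing property the subtracted double sum integrates to `tr (A adj A) = k det A`. -/
theorem IsProjectionKernel.hasIntegral_det_cons (hK : IsProjectionKernel ν K n) {k : ℕ}
    (z : Fin k → X) :
    Integrable (fun u => (kernelMatrix K (Fin.cons u z : Fin (k + 1) → X)).det) ν ∧
    ∫ u, (kernelMatrix K (Fin.cons u z : Fin (k + 1) → X)).det ∂ν =
      ((n : ℂ) - k) * (kernelMatrix K z).det := by
  set A := kernelMatrix K z with hA
  have hsub : ∀ u, (kernelMatrix K (Fin.cons u z : Fin (k + 1) → X)).submatrix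
      Fin.succ Fin.succ = A := by
    intro u
    ext i j
    simp [kernelMatrix, A]
  have hdet : ∀ u, (kernelMatrix K (Fin.cons u z : Fin (k + 1) → X)).det =
      K u u * A.det - ∑ i, ∑ j, A.adjugate j i * (K (z i) u * K u (z j)) := by
    intro u
    rw [det_bordered, hsub]
    congr 1
    refine Finset.sum_congr rfl fun i _ => Finset.sum_congr rfl fun j _ => ?_
    simp only [kernelMatrix, Matrix.of_apply, Fin.cons_zero, Fin.cons_succ]
    ring
  have hI : ∀ i j, Integrable (fun u => A.adjugate j i * (K (z i) u * K u (z j))) ν :=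
    fun i j => (hK.integrable _ _).const_mul _
  have hI1 : ∀ i, Integrable (fun u => ∑ j, A.adjugate j i * (K (z i) u * K u (z j))) ν :=
    fun i => integrable_finsetSum _ fun j _ => hI i j
  have hI2 : Integrable (fun u => ∑ i, ∑ j, A.adjugate j i * (K (z i) u * K u (z j))) ν :=
    integrable_finsetSum _ fun i _ => hI1 i
  have hI0 : Integrable (fun u => K u u * A.det) ν := hK.integrable_diag.mul_const _
  simp only [hdet]
  refine ⟨hI0.sub hI2, ?_⟩
  rw [integral_sub hI0 hI2, integral_mul_const, hK.trace, integral_finsetSum _ fun i _ => hI1 i]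
  have : ∀ i, ∫ u, ∑ j, A.adjugate j i * (K (z i) u * K u (z j)) ∂ν = A.det := by
    intro i
    rw [integral_finsetSum _ fun j _ => hI i j]
    simp only [integral_const_mul, hK.reproducing]
    have h := congrFun (congrFun (Matrix.mul_adjugate A) i) i
    simp only [Matrix.mul_apply, Matrix.smul_apply, Matrix.one_apply_eq, smul_eq_mul,
      mul_one] at h
    rw [← h]
    refine Finset.sum_congr rfl fun j _ => ?_
    simp only [hA, kernelMatrix, Matrix.of_apply]
    ring
  simp only [this, Finset.sum_const, Finset.card_univ, Fintype.card_fin, nsmul_eq_mul]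
  ring

/-- Integrating out one variable of a determinantal density. -/
theorem IsProjectionKernel.lintegral_det_cons (hK : IsProjectionKernel ν K n) {k : ℕ} (hk : k ≤ n)
    (z : Fin k → X) :
    ∫⁻ u, ENNReal.ofReal (kernelMatrix K (Fin.cons u z : Fin (k + 1) → X)).det.re ∂ν =
      ((n - k : ℕ) : ℝ≥0∞) * ENNReal.ofReal (kernelMatrix K z).det.re := by
  obtain ⟨h1, h2⟩ := hK.hasIntegral_det_cons z
  have h3 := integral_re h1
  have h4 := ofReal_integral_eq_lintegral_ofReal h1.re (ae_of_all _ fun u => hK.nonneg _ _)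
  simp only [RCLike.re_to_complex] at h4
  rw [← h4]
  simp only [RCLike.re_to_complex] at h3 ⊢
  rw [h3, h2, ← Nat.cast_sub hk, ← Complex.ofReal_natCast, Complex.re_ofReal_mul,
    ENNReal.ofReal_mul (Nat.cast_nonneg _), ENNReal.ofReal_natCast]

theorem IsProjectionKernel.measurable_det (hK : IsProjectionKernel ν K n) (k : ℕ) :
    Measurable fun z : Fin k → X => ENNReal.ofReal (kernelMatrix K z).det.re := by
  have hm : ∀ i j, Measurable fun z : Fin k → X => K (z i) (z j) := fun i j =>
    hK.meas.comp (f := fun z : Fin k → X => (z i, z j))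
      ((measurable_pi_apply i).prodMk (measurable_pi_apply j))
  refine ENNReal.measurable_ofReal.comp (Complex.measurable_re.comp ?_)
  simp only [Matrix.det_apply', kernelMatrix, Matrix.of_apply]
  exact Finset.measurable_fun_sum _ fun σ _ =>
    (Finset.measurable_fun_prod _ fun i _ => hm _ _).const_mul _

theorem lintegral_pi_fin_succ [SigmaFinite ν] {k : ℕ} {g : (Fin (k + 1) → X) → ℝ≥0∞}
    (hg : Measurable g) :
    ∫⁻ z, g z ∂(Measure.pi fun _ => ν) =
      ∫⁻ z : Fin k → X, ∫⁻ u, g (Fin.cons u z) ∂ν ∂(Measure.pi fun _ => ν) := by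
  have h := (measurePreserving_piFinSuccAbove (fun _ : Fin (k + 1) => ν) 0).symm
  rw [← h.lintegral_comp hg,
    lintegral_prod_symm' (fun a => g ((MeasurableEquiv.piFinSuccAbove (fun _ => X) 0).symm a))
      (hg.comp h.measurable)]
  simp [MeasurableEquiv.piFinSuccAbove_symm_apply, Fin.insertNthEquiv]

/-- An embedding of `k` indices extends by one new value in `n - k` ways. This is the same factor
that integrating out one variable of the determinant produces, so the two cancel in the induction
below. -/
theorem sum_embedding_succ {k : ℕ} (g : (Fin k ↪ Fin n) → ℝ≥0∞) :
    ∑ e : Fin (k + 1) ↪ Fin n, g (Equiv.embeddingFinSucc k (Fin n) e).1 =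
      ((n - k : ℕ) : ℝ≥0∞) * ∑ e, g e := by
  classical
  rw [Equiv.sum_comp (Equiv.embeddingFinSucc k (Fin n)) (fun x => g x.1),
    Fintype.sum_sigma, Finset.mul_sum]
  refine Finset.sum_congr rfl fun e _ => ?_
  have : Fintype.card {i // i ∉ Set.range e} = n - k := by
    rw [Fintype.card_subtype_compl, Fintype.card_fin]
    congr 1
    exact (Set.card_range_of_injective e.injective).trans (Fintype.card_fin k)
  simp only
  rw [Finset.sum_const, Finset.card_univ, this, nsmul_eq_mul]

theorem IsProjectionKernel.lintegral_perm [SigmaFinite ν] (hK : IsProjectionKernel ν K n)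
    (σ : Equiv.Perm (Fin n)) {f : (Fin n → X) → ℝ≥0∞} (hf : Measurable f) :
    ∫⁻ ζ, f (fun i => ζ (σ i)) * ENNReal.ofReal (kernelMatrix K ζ).det.re
        ∂(Measure.pi fun _ => ν) =
      ∫⁻ ζ, f ζ * ENNReal.ofReal (kernelMatrix K ζ).det.re ∂(Measure.pi fun _ => ν) := by
  have h : MeasurePreserving (fun (ζ : Fin n → X) i => ζ (σ i)) (Measure.pi fun _ => ν)
      (Measure.pi fun _ => ν) := by
    have := measurePreserving_arrowCongr' (fun _ : Fin n => ν) (fun _ : Fin n => ν) σ.symm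
      (MeasurableEquiv.refl X) (fun _ => MeasurePreserving.id ν)
    exact this
  have hm : Measurable fun ζ => f ζ * ENNReal.ofReal (kernelMatrix K ζ).det.re :=
    hf.mul (hK.measurable_det n)
  rw [← h.lintegral_comp hm]
  refine lintegral_congr fun ζ => ?_
  congr 3
  exact (Matrix.det_submatrix_equiv_self σ (kernelMatrix K ζ)).symm

/-- The intensities of the unnormalized determinantal law. -/
theorem IsProjectionKernel.lintegral_sum_embedding [SigmaFinite ν] (hK : IsProjectionKernel ν K n)
    {k : ℕ} (hk : k ≤ n) : ∀ {f : (Fin k → X) → ℝ≥0∞}, Measurable f →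
    ∫⁻ ζ : Fin n → X, (∑ e : Fin k ↪ Fin n, f (fun i => ζ (e i))) *
        ENNReal.ofReal (kernelMatrix K ζ).det.re ∂(Measure.pi fun _ => ν) =
      (n.factorial : ℝ≥0∞) *
        ∫⁻ z, f z * ENNReal.ofReal (kernelMatrix K z).det.re ∂(Measure.pi fun _ => ν) := by
  -- Downward induction from `k = n`. At the top the embeddings are the `n!` permutations, which
  -- contribute equally by symmetry. To descend, apply the case `k + 1` to a test function that
  -- ignores the zeroth point; both sides acquire the nonzero factor `n - k`.
  induction hk using Nat.decreasingInduction with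
  | self =>
    intro f hf
    simp only [Finset.sum_mul]
    have hm : ∀ e : Fin n ↪ Fin n, Measurable fun ζ : Fin n → X => f (fun i => ζ (e i)) :=
      fun e => hf.comp (measurable_pi_lambda _ fun i => measurable_pi_apply _)
    rw [lintegral_finsetSum _ fun e _ => (hm e).fun_mul (hK.measurable_det n)]
    have : ∀ e : Fin n ↪ Fin n,
        ∫⁻ ζ, f (fun i => ζ (e i)) * ENNReal.ofReal (kernelMatrix K ζ).det.re
          ∂(Measure.pi fun _ => ν) =
        ∫⁻ ζ, f ζ * ENNReal.ofReal (kernelMatrix K ζ).det.re ∂(Measure.pi fun _ => ν) :=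
      fun e => hK.lintegral_perm e.equivOfFiniteSelfEmbedding hf
    simp [this, Fintype.card_embedding_eq, Nat.descFactorial_self]
  | of_succ k hk ih =>
    intro f hf
    have hf' : Measurable fun z : Fin (k + 1) → X => f (fun i => z i.succ) :=
      hf.comp (measurable_pi_lambda _ fun i => measurable_pi_apply _)
    have h := ih hf'
    have hl : ∀ ζ : Fin n → X, ∑ e : Fin (k + 1) ↪ Fin n, f (fun i => ζ (e i.succ)) =
        ((n - k : ℕ) : ℝ≥0∞) * ∑ e : Fin k ↪ Fin n, f (fun i => ζ (e i)) :=
      fun ζ => sum_embedding_succ fun e => f (fun i => ζ (e i))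
    rw [lintegral_pi_fin_succ (hf'.fun_mul (hK.measurable_det _))] at h
    simp only [hl, Fin.cons_succ, mul_assoc] at h
    rw [lintegral_const_mul' _ _ (ENNReal.natCast_ne_top _)] at h
    have hr : ∀ z : Fin k → X, ∫⁻ u, f z *
        ENNReal.ofReal (kernelMatrix K (Fin.cons u z : Fin (k + 1) → X)).det.re ∂ν =
        ((n - k : ℕ) : ℝ≥0∞) * (f z * ENNReal.ofReal (kernelMatrix K z).det.re) := by
      intro z
      have hm : Measurable fun u : X => (Fin.cons u z : Fin (k + 1) → X) := by
        refine measurable_pi_lambda _ fun i => ?_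
        refine Fin.cases ?_ (fun j => ?_) i
        · simpa using measurable_id'
        · simp
      have hm' : Measurable fun u =>
          ENNReal.ofReal (kernelMatrix K (Fin.cons u z : Fin (k + 1) → X)).det.re :=
        (hK.measurable_det (k + 1)).comp hm
      rw [lintegral_const_mul _ hm', hK.lintegral_det_cons hk.le]
      ring
    simp only [hr] at h
    rw [lintegral_const_mul' _ _ (ENNReal.natCast_ne_top _), mul_left_comm] at h
    refine (ENNReal.mul_right_inj ?_ (ENNReal.natCast_ne_top _)).1 h
    exact_mod_cast (Nat.sub_pos_of_lt hk).ne'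

end Determinantal

/-! ### Weighted monomials and the reproducing kernel -/

instance : SigmaFinite dA := by
  have h : dA = Real.pi⁻¹.toNNReal • (volume : Measure ℂ) := rfl
  rw [h]
  infer_instance

theorem dA_apply (s : Set ℂ) : dA s = ENNReal.ofReal Real.pi⁻¹ * volume s := by
  simp [dA]

theorem integrable_dA_iff {E : Type*} [NormedAddCommGroup E] {f : ℂ → E} :
    Integrable f dA ↔ Integrable f volume :=
  integrable_smul_measure (by simp [Real.pi_pos]) ENNReal.ofReal_ne_top

section

variable {Q : ℂ → EReal} {n : ℕ}

theorem weight_pos {ζ : ℂ} (h : Q ζ ≠ ⊤) : 0 < weight Q n ζ := by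
  rw [weight, if_neg h]
  exact Real.exp_pos _

theorem measurable_weight (hQ : IsAdmissible Q) (n : ℕ) : Measurable (weight Q n) := by
  have hm : Measurable Q := hQ.lsc.measurable
  unfold weight
  refine Measurable.ite (hm (measurableSet_singleton ⊤)) measurable_const ?_
  exact Real.measurable_exp.comp (((hm.ereal_toReal.const_mul _).neg).div_const _)

theorem weight_sq_le_of_le {ζ : ℂ} {m : ℝ} (hbot : Q ζ ≠ ⊥) (h : (m : EReal) ≤ Q ζ) :
    weight Q n ζ ^ 2 ≤ Real.exp (-(n * m)) := by
  unfold weight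
  split_ifs with ht
  · simpa using (Real.exp_pos _).le
  · rw [← Real.exp_nat_mul]
    refine Real.exp_le_exp.2 ?_
    have h1 : m ≤ (Q ζ).toReal := by
      rwa [← EReal.coe_le_coe_iff, EReal.coe_toReal ht hbot]
    have := mul_le_mul_of_nonneg_left h1 (Nat.cast_nonneg (α := ℝ) n)
    push_cast
    linarith

theorem IsAdmissible.exists_log_le (hQ : IsAdmissible Q) :
    ∃ c R : ℝ, 2 < c ∧ 1 < R ∧ ∀ z : ℂ, R < ‖z‖ → ((c * Real.log ‖z‖ : ℝ) : EReal) ≤ Q z := by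
  obtain ⟨c, hc2, hc⟩ := EReal.lt_iff_exists_real_btwn.1 hQ.growth
  have h := eventually_lt_of_lt_liminf hc
  rw [← Metric.cobounded_eq_cocompact, ← comap_norm_atTop, eventually_comap] at h
  obtain ⟨R, hR⟩ := eventually_atTop.1 h
  refine ⟨c, max R 2, EReal.coe_lt_coe_iff.1 hc2, by simp, fun z hz => ?_⟩
  have h1 := hR ‖z‖ ((le_max_left _ _).trans hz.le) z rfl
  have h2 : 0 < Real.log ‖z‖ :=
    Real.log_pos (by linarith [le_max_right R 2])
  have h3 := (EReal.le_div_iff_mul_le (by exact_mod_cast h2) (EReal.coe_ne_top _)).1 h1.le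
  simpa using h3

theorem IsAdmissible.exists_lower_bound (hQ : IsAdmissible Q) (R : ℝ) :
    ∃ m : ℝ, ∀ z : ℂ, ‖z‖ ≤ R → (m : EReal) ≤ Q z := by
  rcases lt_or_ge R 0 with hR | hR
  · exact ⟨0, fun z hz => absurd (norm_nonneg z) (by linarith)⟩
  obtain ⟨a, -, ha⟩ := (hQ.lsc.lowerSemicontinuousOn _).exists_isMinOn
    (s := Metric.closedBall (0 : ℂ) R) ⟨0, by simpa⟩ (isCompact_closedBall 0 R)
  by_cases ht : Q a = ⊤
  · refine ⟨0, fun z hz => ?_⟩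
    have := ha (show z ∈ Metric.closedBall (0 : ℂ) R by simpa using hz)
    rw [Set.mem_ofPred_eq, ht, top_le_iff] at this
    simp [this]
  · refine ⟨(Q a).toReal, fun z hz => ?_⟩
    rw [EReal.coe_toReal ht (hQ.ne_bot a)]
    exact ha (show z ∈ Metric.closedBall (0 : ℂ) R by simpa using hz)

/-- The weighted monomials `ζ^i e^{-nQ/2}`. -/
def weightedMonomial (Q : ℂ → EReal) (n : ℕ) (i : Fin n) (ζ : ℂ) : ℂ :=
  ζ ^ (i : ℕ) * (weight Q n ζ : ℂ)

theorem measurable_weightedMonomial (hQ : IsAdmissible Q) (i : Fin n) :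
    Measurable (weightedMonomial Q n i) := by
  have := measurable_weight hQ n
  unfold weightedMonomial
  fun_prop

theorem norm_sq_weightedMonomial (i : Fin n) (ζ : ℂ) :
    ‖weightedMonomial Q n i ζ‖ ^ 2 = ‖ζ‖ ^ (2 * (i : ℕ)) * weight Q n ζ ^ 2 := by
  rw [weightedMonomial, norm_mul, norm_pow, Complex.norm_real, mul_pow, Real.norm_eq_abs, sq_abs,
    ← pow_mul, mul_comm (i : ℕ)]

/-- Since `Q ≥ c log|ζ|` near infinity with `c > 2`, and `i ≤ n - 1`, the squared modulus decays
with exponent `r = nc - 2i > 2`, which is what integrability over the plane requires. On the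
remaining disc semicontinuity bounds `Q` below. -/
theorem exists_weightedMonomial_bound (hQ : IsAdmissible Q) (i : Fin n) :
    ∃ C r : ℝ, 2 < r ∧ ∀ ζ, ‖weightedMonomial Q n i ζ‖ ^ 2 ≤ C * (1 + ‖ζ‖) ^ (-r) := by
  obtain ⟨c, R, hc, hR, hlog⟩ := hQ.exists_log_le
  obtain ⟨m, hm⟩ := hQ.exists_lower_bound R
  have hn : (1 : ℝ) ≤ n := by exact_mod_cast (i.pos : 0 < n)
  have hi : (i : ℝ) + 1 ≤ n := by exact_mod_cast i.isLt
  set r : ℝ := n * c - 2 * i with hr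
  have hr2 : 2 < r := by nlinarith
  -- The first constant serves the disc `|ζ| ≤ R`. The second serves its complement, where `|ζ| > 1`
  -- gives `|ζ| ≥ (1 + |ζ|) / 2`.
  refine ⟨max (R ^ (2 * (i : ℕ)) * Real.exp (-(n * m)) * (1 + R) ^ r) (2 ^ r), r, hr2,
    fun ζ => ?_⟩
  rw [norm_sq_weightedMonomial]
  have h0 := norm_nonneg ζ
  have hpos : 0 < (1 + ‖ζ‖) ^ (-r) := Real.rpow_pos_of_pos (by linarith) _
  rcases le_or_gt ‖ζ‖ R with hζ | hζ
  · refine le_trans ?_ (mul_le_mul_of_nonneg_right (le_max_left _ _) hpos.le)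
    have h1 : ‖ζ‖ ^ (2 * (i : ℕ)) * weight Q n ζ ^ 2 ≤
        R ^ (2 * (i : ℕ)) * Real.exp (-(n * m)) :=
      mul_le_mul (pow_le_pow_left₀ h0 hζ _) (weight_sq_le_of_le (hQ.ne_bot ζ) (hm ζ hζ))
        (sq_nonneg _) (by positivity)
    have h2 : 1 ≤ (1 + R) ^ r * (1 + ‖ζ‖) ^ (-r) := by
      rw [Real.rpow_neg (by linarith), ← div_eq_mul_inv,
        one_le_div (Real.rpow_pos_of_pos (by linarith) _)]
      exact Real.rpow_le_rpow (by linarith) (by linarith) (by linarith)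
    have h3 : 0 ≤ R ^ (2 * (i : ℕ)) * Real.exp (-(n * m)) := by positivity
    calc _ ≤ R ^ (2 * (i : ℕ)) * Real.exp (-(n * m)) * 1 := by rwa [mul_one]
      _ ≤ _ := by
        rw [mul_assoc _ ((1 + R) ^ r)]
        exact mul_le_mul_of_nonneg_left h2 h3
  · refine le_trans ?_ (mul_le_mul_of_nonneg_right (le_max_right _ _) hpos.le)
    have hz : 0 < ‖ζ‖ := by linarith
    have h1 := weight_sq_le_of_le (n := n) (hQ.ne_bot ζ) (hlog ζ hζ)
    have h2 : Real.exp (-(n * (c * Real.log ‖ζ‖))) = ‖ζ‖ ^ (-(n * c)) := by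
      rw [Real.rpow_def_of_pos hz]
      ring_nf
    calc _ ≤ ‖ζ‖ ^ (2 * (i : ℕ)) * ‖ζ‖ ^ (-(n * c)) :=
          mul_le_mul_of_nonneg_left (h2 ▸ h1) (by positivity)
      _ = ‖ζ‖ ^ (-r) := by
          rw [← Real.rpow_natCast, ← Real.rpow_add hz]
          congr 1
          push_cast
          ring
      _ ≤ ((1 + ‖ζ‖) / 2) ^ (-r) :=
          Real.rpow_le_rpow_of_nonpos (by linarith) (by linarith) (by linarith)
      _ = 2 ^ r * (1 + ‖ζ‖) ^ (-r) := by
          rw [Real.div_rpow (by linarith) (by norm_num), Real.rpow_neg (by norm_num : (0:ℝ) ≤ 2)]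
          field_simp

theorem memLp_weightedMonomial (hQ : IsAdmissible Q) (i : Fin n) :
    MemLp (weightedMonomial Q n i) 2 dA := by
  have hm := measurable_weightedMonomial hQ i
  rw [memLp_two_iff_integrable_sq_norm hm.aestronglyMeasurable, integrable_dA_iff]
  obtain ⟨C, r, hr, h⟩ := exists_weightedMonomial_bound hQ i
  have hI : Integrable (fun ζ : ℂ => C * (1 + ‖ζ‖) ^ (-r)) volume :=
    (integrable_one_add_norm (by simpa using hr)).const_mul C
  refine hI.mono' (hm.norm.pow_const 2).aestronglyMeasurable (ae_of_all _ fun ζ => ?_)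
  rw [Real.norm_of_nonneg (sq_nonneg _)]
  exact h ζ

theorem integrable_conj_mul (hQ : IsAdmissible Q) (i j : Fin n) :
    Integrable (fun ζ => conj (weightedMonomial Q n i ζ) * weightedMonomial Q n j ζ) dA :=
  MemLp.integrable_mul (memLp_weightedMonomial hQ i).star (memLp_weightedMonomial hQ j)

/-- The Gram matrix of the weighted monomials. -/
def gram (Q : ℂ → EReal) (n : ℕ) : Matrix (Fin n) (Fin n) ℂ :=
  Matrix.of fun i j => ∫ ζ, conj (weightedMonomial Q n i ζ) * weightedMonomial Q n j ζ ∂dA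

theorem gram_isHermitian (Q : ℂ → EReal) (n : ℕ) : (gram Q n).IsHermitian := by
  ext i j
  simp only [gram, Matrix.conjTranspose_apply, Matrix.of_apply, RCLike.star_def, ← integral_conj]
  congr 1
  ext ζ
  simp [mul_comm]

theorem dotProduct_gram (hQ : IsAdmissible Q) (x : Fin n → ℂ) :
    star x ⬝ᵥ (gram Q n).mulVec x =
      ((∫ ζ, ‖∑ i, x i * weightedMonomial Q n i ζ‖ ^ 2 ∂dA : ℝ) : ℂ) := by
  have hI : ∀ i j, Integrable (fun ζ => conj (x i) *
      (conj (weightedMonomial Q n i ζ) * weightedMonomial Q n j ζ * x j)) dA :=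
    fun i j => ((integrable_conj_mul hQ i j).mul_const _).const_mul _
  have h : ∀ ζ, ((‖∑ i, x i * weightedMonomial Q n i ζ‖ ^ 2 : ℝ) : ℂ) = ∑ i, ∑ j,
      conj (x i) * (conj (weightedMonomial Q n i ζ) * weightedMonomial Q n j ζ * x j) := by
    intro ζ
    push_cast
    rw [← Complex.conj_mul', map_sum, Finset.sum_mul_sum]
    refine Finset.sum_congr rfl fun i _ => Finset.sum_congr rfl fun j _ => ?_
    rw [map_mul]
    ring
  rw [← integral_complex_ofReal]
  simp only [h]
  rw [integral_finsetSum _ fun i _ => integrable_finsetSum _ fun j _ => hI i j]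
  simp only [dotProduct, Matrix.mulVec, Finset.mul_sum]
  refine Finset.sum_congr rfl fun i _ => ?_
  rw [integral_finsetSum _ fun j _ => hI i j]
  refine Finset.sum_congr rfl fun j _ => ?_
  rw [integral_const_mul, integral_mul_const]
  rfl

theorem sum_weightedMonomial (x : Fin n → ℂ) (ζ : ℂ) :
    ∑ i, x i * weightedMonomial Q n i ζ =
      (∑ i : Fin n, Polynomial.monomial (i : ℕ) (x i)).eval ζ * (weight Q n ζ : ℂ) := by
  simp [Polynomial.eval_finsetSum, Finset.sum_mul, weightedMonomial, mul_assoc]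

/-- A nonzero polynomial has finitely many zeros and the weight is positive on `U`, so a nontrivial
combination of weighted monomials is nonzero on a set of positive area. -/
theorem gram_posDef (hQ : IsAdmissible Q) {U : Set ℂ} (hU : IsOpen U) (hne : U.Nonempty)
    (hfin : ∀ z ∈ U, Q z ≠ ⊤) : (gram Q n).PosDef := by
  refine Matrix.PosDef.of_dotProduct_mulVec_pos (gram_isHermitian Q n) fun x hx => ?_
  rw [dotProduct_gram hQ, Complex.zero_lt_real]
  set q : Polynomial ℂ := ∑ i : Fin n, Polynomial.monomial (i : ℕ) (x i) with hq
  have hq0 : q ≠ 0 := by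
    obtain ⟨i, hi⟩ := Function.ne_iff.1 hx
    intro h
    apply hi
    have := congrArg (fun p => p.coeff (i : ℕ)) h
    simpa [hq, Polynomial.finsetSum_coeff, Polynomial.coeff_monomial, Fin.val_inj] using this
  have hmem : MemLp (fun ζ => ∑ i, x i * weightedMonomial Q n i ζ) 2 dA :=
    memLp_finsetSum _ fun i _ => (memLp_weightedMonomial hQ i).const_mul _
  rw [integral_pos_iff_support_of_nonneg (fun ζ => sq_nonneg _)
    ((memLp_two_iff_integrable_sq_norm hmem.1).1 hmem)]
  have hsub : U \ (q.roots.toFinset : Set ℂ) ⊆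
      Function.support fun ζ => ‖∑ i, x i * weightedMonomial Q n i ζ‖ ^ 2 := by
    intro ζ hζ
    have h1 : q.eval ζ ≠ 0 := fun h => hζ.2 (by simpa [hq0] using h)
    have h2 := (weight_pos (n := n) (hfin ζ hζ.1)).ne'
    rw [Function.mem_support, sum_weightedMonomial, ← hq]
    simpa using ⟨h1, h2⟩
  refine lt_of_lt_of_le ?_ (measure_mono hsub)
  rw [dA_apply, measure_sdiff_null (Set.Finite.measure_zero (Finset.finite_toSet _) _)]
  exact ENNReal.mul_pos (by simp [Real.pi_pos]) (hU.measure_pos volume hne).ne'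

/-- The kernel `∑ v_i(ζ) (G⁻¹)_{ij} conj v_j(η)` built from the weighted monomials `v_i` and their
Gram matrix `G`. -/
def gramKernel (Q : ℂ → EReal) (n : ℕ) (ζ η : ℂ) : ℂ :=
  ∑ i, ∑ j, weightedMonomial Q n i ζ * (gram Q n)⁻¹ i j * conj (weightedMonomial Q n j η)

theorem gramKernel_hermitian (hG : (gram Q n).PosDef) (ζ η : ℂ) :
    gramKernel Q n ζ η = conj (gramKernel Q n η ζ) := by
  have h : ∀ i j, conj ((gram Q n)⁻¹ i j) = (gram Q n)⁻¹ j i := fun i j =>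
    congrFun (congrFun hG.inv.isHermitian j) i
  simp only [gramKernel, map_sum, map_mul, Complex.conj_conj, h]
  rw [Finset.sum_comm]
  refine Finset.sum_congr rfl fun i _ => Finset.sum_congr rfl fun j _ => ?_
  ring

theorem integral_gramKernel_mul (hQ : IsAdmissible Q) (hG : (gram Q n).PosDef) (η : ℂ)
    (k : Fin n) :
    Integrable (fun ζ => gramKernel Q n η ζ * weightedMonomial Q n k ζ) dA ∧
    ∫ ζ, gramKernel Q n η ζ * weightedMonomial Q n k ζ ∂dA = weightedMonomial Q n k η := by
  have hI : ∀ i j, Integrable (fun ζ => weightedMonomial Q n i η * (gram Q n)⁻¹ i j *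
      (conj (weightedMonomial Q n j ζ) * weightedMonomial Q n k ζ)) dA :=
    fun i j => (integrable_conj_mul hQ j k).const_mul _
  have h : ∀ ζ, gramKernel Q n η ζ * weightedMonomial Q n k ζ =
      ∑ i, ∑ j, weightedMonomial Q n i η * (gram Q n)⁻¹ i j *
      (conj (weightedMonomial Q n j ζ) * weightedMonomial Q n k ζ) := by
    intro ζ
    simp only [gramKernel, Finset.sum_mul, mul_assoc]
  simp only [h]
  refine ⟨integrable_finsetSum _ fun i _ => integrable_finsetSum _ fun j _ => hI i j, ?_⟩
  rw [integral_finsetSum _ fun i _ => integrable_finsetSum _ fun j _ => hI i j]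
  have h1 : ∀ i, ∫ ζ, ∑ j, weightedMonomial Q n i η * (gram Q n)⁻¹ i j *
      (conj (weightedMonomial Q n j ζ) * weightedMonomial Q n k ζ) ∂dA =
      weightedMonomial Q n i η * (1 : Matrix (Fin n) (Fin n) ℂ) i k := by
    intro i
    rw [integral_finsetSum _ fun j _ => hI i j,
      ← Matrix.nonsing_inv_mul (gram Q n) hG.det_pos.ne'.isUnit, Matrix.mul_apply,
      Finset.mul_sum]
    refine Finset.sum_congr rfl fun j _ => ?_
    rw [integral_const_mul, mul_assoc]
    rfl
  simp [h1, Matrix.one_apply]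

theorem isWeightedPoly_iff {f : ℂ → ℂ} : IsWeightedPoly Q n f ↔
    ∃ x : Fin n → ℂ, ∀ ζ, f ζ = ∑ i, x i * weightedMonomial Q n i ζ := by
  constructor
  · rintro ⟨q, hq, h⟩
    refine ⟨fun i => q.coeff i, fun ζ => ?_⟩
    rw [h, sum_weightedMonomial]
    congr 2
    ext k
    simp only [Polynomial.finsetSum_coeff, Polynomial.coeff_monomial]
    by_cases hk : k < n
    · rw [Finset.sum_eq_single ⟨k, hk⟩] <;> simp +contextual [Fin.ext_iff]
    · rw [Polynomial.coeff_eq_zero_of_degree_lt (hq.trans_le (by exact_mod_cast not_lt.1 hk)),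
        Finset.sum_eq_zero]
      intro i _
      rw [if_neg (by omega)]
  · rintro ⟨x, h⟩
    refine ⟨∑ i : Fin n, Polynomial.monomial (i : ℕ) (x i), ?_, fun ζ => ?_⟩
    · refine Polynomial.mem_degreeLT.1 (Submodule.sum_mem _ fun i _ => ?_)
      refine Polynomial.mem_degreeLT.2 ?_
      exact (Polynomial.degree_monomial_le _ _).trans_lt (by exact_mod_cast i.isLt)
    · rw [h, sum_weightedMonomial]

theorem isReproducingKernel_gramKernel (hQ : IsAdmissible Q) (hG : (gram Q n).PosDef) :
    IsReproducingKernel Q n (gramKernel Q n) := by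
  refine ⟨fun η => isWeightedPoly_iff.2
    ⟨fun i => ∑ j, (gram Q n)⁻¹ i j * conj (weightedMonomial Q n j η), fun ζ => ?_⟩, ?_⟩
  · simp only [gramKernel, Finset.sum_mul]
    refine Finset.sum_congr rfl fun i _ => Finset.sum_congr rfl fun j _ => ?_
    ring
  · intro f hf η
    obtain ⟨x, hx⟩ := isWeightedPoly_iff.1 hf
    have h : ∀ ζ, f ζ * conj (gramKernel Q n ζ η) =
        ∑ i, x i * (gramKernel Q n η ζ * weightedMonomial Q n i ζ) := by
      intro ζ
      rw [← gramKernel_hermitian hG, hx, Finset.sum_mul]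
      refine Finset.sum_congr rfl fun i _ => ?_
      ring
    simp only [h]
    rw [integral_finsetSum _ fun i _ => ((integral_gramKernel_mul hQ hG η i).1.const_mul _), hx]
    refine Finset.sum_congr rfl fun i _ => ?_
    rw [integral_const_mul, (integral_gramKernel_mul hQ hG η i).2]

theorem kernel_eq_gramKernel (hQ : IsAdmissible Q) (hG : (gram Q n).PosDef) :
    kernel Q n = gramKernel Q n := by
  have h : ∃ K, IsReproducingKernel Q n K := ⟨_, isReproducingKernel_gramKernel hQ hG⟩
  rw [kernel, dif_pos h]
  exact h.choose_spec.unique (isReproducingKernel_gramKernel hQ hG)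

theorem kernelMatrix_gramKernel {k : ℕ} (z : Fin k → ℂ) :
    kernelMatrix (gramKernel Q n) z =
      (Matrix.of fun i j => weightedMonomial Q n j (z i)) * (gram Q n)⁻¹ *
        (Matrix.of fun i j => weightedMonomial Q n j (z i)).conjTranspose := by
  ext a b
  simp only [kernelMatrix, gramKernel, Matrix.of_apply, Matrix.mul_apply,
    Matrix.conjTranspose_apply, RCLike.star_def, Finset.sum_mul]
  rw [Finset.sum_comm]

theorem det_kernelMatrix_gramKernel_nonneg (hG : (gram Q n).PosDef) {k : ℕ} (z : Fin k → ℂ) :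
    0 ≤ (kernelMatrix (gramKernel Q n) z).det := by
  rw [kernelMatrix_gramKernel]
  exact (hG.inv.posSemidef.mul_mul_conjTranspose_same _).det_nonneg

/-- The matrix factors through `ℂ^n`, so its rank is at most `n`. This is the analytic counterpart
of there being no `k` distinct indices among `n` when `k > n`. -/
theorem det_kernelMatrix_gramKernel_eq_zero {k : ℕ} (hk : n < k) (z : Fin k → ℂ) :
    (kernelMatrix (gramKernel Q n) z).det = 0 := by
  by_contra h
  have h1 := Matrix.rank_of_isUnit _
    ((Matrix.isUnit_iff_isUnit_det (kernelMatrix (gramKernel Q n) z)).2 (isUnit_iff_ne_zero.2 h))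
  rw [kernelMatrix_gramKernel, Matrix.mul_assoc, Fintype.card_fin] at h1
  have h2 := (Matrix.rank_mul_le_left (Matrix.of fun i j => weightedMonomial Q n j (z i))
    ((gram Q n)⁻¹ * (Matrix.of fun i j => weightedMonomial Q n j (z i)).conjTranspose)).trans
    (Matrix.rank_le_width _)
  omega

theorem isProjectionKernel_gramKernel (hQ : IsAdmissible Q) (hG : (gram Q n).PosDef) :
    IsProjectionKernel dA (gramKernel Q n) n where
  meas := by
    have h := measurable_weightedMonomial (n := n) hQ
    unfold gramKernel
    refine Finset.measurable_fun_sum _ fun i _ => Finset.measurable_fun_sum _ fun j _ => ?_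
    refine (((h i).comp measurable_fst).mul_const _).fun_mul ?_
    exact Complex.continuous_conj.measurable.comp ((h j).comp measurable_snd)
  nonneg k z := (Complex.nonneg_iff.1 (det_kernelMatrix_gramKernel_nonneg hG z)).1
  integrable x y := by
    have h : ∀ u, gramKernel Q n x u * gramKernel Q n u y = ∑ i, ∑ j,
        gramKernel Q n x u * weightedMonomial Q n i u *
          ((gram Q n)⁻¹ i j * conj (weightedMonomial Q n j y)) := by
      intro u
      conv_lhs => rw [gramKernel.eq_def Q n u y]
      simp only [Finset.mul_sum, mul_assoc]
    simp only [h]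
    exact integrable_finsetSum _ fun i _ => integrable_finsetSum _ fun j _ =>
      (integral_gramKernel_mul hQ hG x i).1.mul_const _
  reproducing x y := by
    have hK := isReproducingKernel_gramKernel hQ hG
    rw [hK.2 _ (hK.1 y) x]
    congr 1
    ext u
    rw [← gramKernel_hermitian hG, mul_comm]
  integrable_diag := by
    have h : ∀ u, gramKernel Q n u u = ∑ i, ∑ j, (gram Q n)⁻¹ i j *
        (conj (weightedMonomial Q n j u) * weightedMonomial Q n i u) := by
      intro u
      refine Finset.sum_congr rfl fun i _ => Finset.sum_congr rfl fun j _ => ?_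
      ring
    simp only [h]
    exact integrable_finsetSum _ fun i _ => integrable_finsetSum _ fun j _ =>
      (integrable_conj_mul hQ j i).const_mul _
  trace := by
    have hI : ∀ i j, Integrable (fun u => (gram Q n)⁻¹ i j *
        (conj (weightedMonomial Q n j u) * weightedMonomial Q n i u)) dA :=
      fun i j => (integrable_conj_mul hQ j i).const_mul _
    have h : ∀ u, gramKernel Q n u u = ∑ i, ∑ j, (gram Q n)⁻¹ i j *
        (conj (weightedMonomial Q n j u) * weightedMonomial Q n i u) := by
      intro u
      refine Finset.sum_congr rfl fun i _ => Finset.sum_congr rfl fun j _ => ?_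
      ring
    simp only [h]
    rw [integral_finsetSum _ fun i _ => integrable_finsetSum _ fun j _ => hI i j]
    have h1 : ∀ i, ∫ u, ∑ j, (gram Q n)⁻¹ i j *
        (conj (weightedMonomial Q n j u) * weightedMonomial Q n i u) ∂dA = 1 := by
      intro i
      rw [integral_finsetSum _ fun j _ => hI i j]
      have h2 := congrFun (congrFun
        (Matrix.nonsing_inv_mul (gram Q n) hG.det_pos.ne'.isUnit) i) i
      rw [Matrix.mul_apply, Matrix.one_apply_eq] at h2
      rw [← h2]
      refine Finset.sum_congr rfl fun j _ => ?_
      rw [integral_const_mul]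
      rfl
    simp [h1]

end

/-! ### The Boltzmann-Gibbs law as a determinantal law -/

theorem ereal_exp_sum {ι : Type*} (s : Finset ι) (f : ι → EReal) :
    EReal.exp (∑ i ∈ s, f i) = ∏ i ∈ s, EReal.exp (f i) := by
  classical
  induction s using Finset.induction_on with
  | empty => simp
  | insert a s ha ih => rw [Finset.sum_insert ha, Finset.prod_insert ha, EReal.exp_add, ih]

theorem ennreal_prod_inv {ι : Type*} {s : Finset ι} {f : ι → ℝ≥0∞} (hf : ∀ i ∈ s, f i ≠ 0) :
    (∏ i ∈ s, f i)⁻¹ = ∏ i ∈ s, (f i)⁻¹ :=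
  ENNReal.prod_inv_distrib fun i hi _ _ _ => Or.inl (hf i hi)

theorem exp_logKernel_inv (ζ η : ℂ) : (EReal.exp (logKernel ζ η))⁻¹ = ‖ζ - η‖ₑ := by
  rw [logKernel, EReal.exp_neg, ENNReal.exp_log, inv_inv]

section

variable {Q : ℂ → EReal} {n : ℕ}

/-- The condition `n ≠ 0` matters where `Q = ⊤`: the left side is a power of `0`, while `weight` is
`0` there by convention. -/
theorem exp_inv_pow_eq_weight (hQ : IsAdmissible Q) (hn : n ≠ 0) (ζ : ℂ) :
    (EReal.exp (Q ζ))⁻¹ ^ n = ENNReal.ofReal (weight Q n ζ ^ 2) := by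
  unfold weight
  split_ifs with h
  · simp [h, hn]
  · rw [← EReal.exp_neg, ← EReal.coe_toReal h (hQ.ne_bot ζ), ← EReal.coe_neg, EReal.exp_coe,
      ← ENNReal.ofReal_pow (Real.exp_pos _).le, ← Real.exp_nat_mul, ← Real.exp_nat_mul,
      EReal.toReal_coe]
    congr 2
    push_cast
    ring

theorem prod_enorm_sub (ζ : Fin n → ℂ) :
    ∏ j, ∏ k with k ≠ j, ‖ζ j - ζ k‖ₑ = ‖(Matrix.vandermonde ζ).det‖ₑ ^ 2 := by
  have h := Finset.prod_prod_Ioi_mul_eq_prod_prod_off_diag (fun i j : Fin n => ‖ζ j - ζ i‖ₑ)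
  have h1 : ∀ j : Fin n, Finset.univ.filter (fun k => k ≠ j) = {j}ᶜ := by
    intro j
    ext k
    simp
  simp only [h1]
  rw [← h, Matrix.det_vandermonde, sq]
  have h2 : ‖∏ i : Fin n, ∏ j ∈ Finset.Ioi i, (ζ j - ζ i)‖ₑ =
      ∏ i : Fin n, ∏ j ∈ Finset.Ioi i, ‖ζ j - ζ i‖ₑ := by
    simp only [← ofReal_norm, norm_prod]
    rw [ENNReal.ofReal_prod_of_nonneg fun _ _ => by positivity]
    exact Finset.prod_congr rfl fun _ _ => ENNReal.ofReal_prod_of_nonneg fun _ _ => by positivity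
  rw [h2, ← Finset.prod_mul_distrib]
  refine Finset.prod_congr rfl fun i _ => ?_
  rw [← Finset.prod_mul_distrib]
  refine Finset.prod_congr rfl fun j _ => ?_
  rw [← enorm_neg (ζ i - ζ j), neg_sub]

theorem exp_neg_hamiltonian (hQ : IsAdmissible Q) (ζ : Fin n → ℂ) :
    EReal.exp (-hamiltonian Q n ζ) = ENNReal.ofReal
      (‖(Matrix.vandermonde ζ).det‖ ^ 2 * ∏ i, weight Q n (ζ i) ^ 2) := by
  -- Inversion in `[0, ∞]` distributes over products as long as no `0 · ∞` occurs. The exponentials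
  -- are never `0`, because neither the logarithmic kernel nor `Q` takes the value `⊥`.
  have hL : ∀ j k, EReal.exp (logKernel (ζ j) (ζ k)) ≠ 0 := fun j k => by
    rw [← ENNReal.inv_ne_top, exp_logKernel_inv]
    exact enorm_ne_top
  have hE : ∀ j, EReal.exp (Q (ζ j)) ≠ 0 := fun j => by
    simpa using hQ.ne_bot (ζ j)
  have hP : ∏ j, ∏ k with k ≠ j, EReal.exp (logKernel (ζ j) (ζ k)) ≠ 0 :=
    Finset.prod_ne_zero_iff.2 fun j _ => Finset.prod_ne_zero_iff.2 fun k _ => hL j k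
  have hP' : (∏ j, EReal.exp (Q (ζ j))) ^ n ≠ 0 :=
    pow_ne_zero _ (Finset.prod_ne_zero_iff.2 fun j _ => hE j)
  rw [EReal.exp_neg, hamiltonian, EReal.exp_add, EReal.exp_nmul]
  simp only [ereal_exp_sum]
  rw [ENNReal.mul_inv (Or.inl hP) (Or.inr hP'), ENNReal.inv_pow,
    ennreal_prod_inv fun j _ => hE j,
    ennreal_prod_inv fun j _ => Finset.prod_ne_zero_iff.2 fun k _ => hL j k,
    ENNReal.ofReal_mul (by positivity), ENNReal.ofReal_pow (norm_nonneg _), ofReal_norm,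
    ← prod_enorm_sub, ENNReal.ofReal_prod_of_nonneg fun _ _ => sq_nonneg _, ← Finset.prod_pow]
  congr 1
  · refine Finset.prod_congr rfl fun j _ => ?_
    rw [ennreal_prod_inv fun k _ => hL j k]
    simp only [exp_logKernel_inv]
  · refine Finset.prod_congr rfl fun j _ => ?_
    exact exp_inv_pow_eq_weight hQ (Fin.pos j).ne' (ζ j)

theorem det_kernelMatrix_gramKernel (hG : (gram Q n).PosDef) (ζ : Fin n → ℂ) :
    (gram Q n).det.re * (kernelMatrix (gramKernel Q n) ζ).det.re =
      ‖(Matrix.vandermonde ζ).det‖ ^ 2 * ∏ i, weight Q n (ζ i) ^ 2 := by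
  have hd := Complex.pos_iff.1 hG.det_pos
  have hd' : (((gram Q n).det.re : ℝ) : ℂ) = (gram Q n).det := by
    apply Complex.ext
    · simp
    · simpa using hd.2
  have hX : (Matrix.of fun i j => weightedMonomial Q n j (ζ i)).det =
      (∏ i, (weight Q n (ζ i) : ℂ)) * (Matrix.vandermonde ζ).det := by
    rw [← Matrix.det_mul_column]
    congr 1
    ext i j
    simp [weightedMonomial, mul_comm]
  have h : (gram Q n).det * (kernelMatrix (gramKernel Q n) ζ).det =
      ((‖(Matrix.vandermonde ζ).det‖ ^ 2 * ∏ i, weight Q n (ζ i) ^ 2 : ℝ) : ℂ) := by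
    rw [kernelMatrix_gramKernel, Matrix.det_mul, Matrix.det_mul, Matrix.det_conjTranspose, hX,
      Matrix.det_nonsing_inv, Ring.inverse_eq_inv']
    have h0 := hG.det_pos.ne'
    push_cast
    rw [← Complex.mul_conj', Finset.prod_pow, RCLike.star_def, map_mul, map_prod]
    simp only [Complex.conj_ofReal]
    field_simp
  rw [← Complex.re_ofReal_mul, hd', h, Complex.ofReal_re]

/-- The Gram determinant is a common factor of the weight and of its total mass, so normalization
removes it and leaves `1 / n!`. -/
theorem gibbs_eq (hQ : IsAdmissible Q) (hG : (gram Q n).PosDef) :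
    gibbs Q n = (n.factorial : ℝ≥0∞)⁻¹ • (dV n).withDensity
      fun ζ => ENNReal.ofReal (kernelMatrix (gramKernel Q n) ζ).det.re := by
  have hK := isProjectionKernel_gramKernel hQ hG
  have hd := (Complex.pos_iff.1 hG.det_pos).1
  set D := (dV n).withDensity
      fun ζ => ENNReal.ofReal (kernelMatrix (gramKernel Q n) ζ).det.re with hD
  have hw : gibbsWeight Q n = ENNReal.ofReal (gram Q n).det.re • D := by
    rw [gibbsWeight, hD, ← withDensity_smul _ (hK.measurable_det n)]
    congr 1
    ext ζ
    rw [exp_neg_hamiltonian hQ, ← det_kernelMatrix_gramKernel hG, ENNReal.ofReal_mul hd.le]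
    rfl
  -- The total mass is the case `k = 0` of the intensity formula.
  have huniv : D Set.univ = n.factorial := by
    have h := hK.lintegral_sum_embedding (Nat.zero_le n) (f := fun _ => 1) measurable_const
    rw [hD, withDensity_apply _ MeasurableSet.univ, Measure.restrict_univ]
    simpa [kernelMatrix, dV] using h
  have hc0 : ENNReal.ofReal (gram Q n).det.re ≠ 0 := by simpa using hd
  rw [gibbs, hw, Measure.smul_apply, huniv, smul_smul, smul_eq_mul,
    ENNReal.mul_inv (Or.inl hc0) (Or.inl ENNReal.ofReal_ne_top), mul_right_comm,
    ENNReal.inv_mul_cancel hc0 ENNReal.ofReal_ne_top, one_mul]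

theorem isCorrelationKernel_gibbs (hQ : IsAdmissible Q) (hG : (gram Q n).PosDef) :
    IsCorrelationKernel (gibbs Q n) (gramKernel Q n) := by
  have hK := isProjectionKernel_gramKernel hQ hG
  refine ⟨gramKernel_hermitian hG, fun k => ⟨hK.nonneg k, fun f hf => ?_⟩⟩
  rcases le_or_gt k n with hk | hk
  · have hm : Measurable fun ζ : Fin n → ℂ => ∑ e : Fin k ↪ Fin n, f (fun i => ζ (e i)) :=
      Finset.measurable_fun_sum _ fun e _ =>
        hf.comp (measurable_pi_lambda _ fun i => measurable_pi_apply _)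
    rw [gibbs_eq hQ hG, lintegral_smul_measure,
      lintegral_withDensity_eq_lintegral_mul _ (hK.measurable_det n) hm]
    have h := hK.lintegral_sum_embedding hk hf
    simp only [Pi.mul_apply, mul_comm (ENNReal.ofReal _)]
    rw [dV, h, smul_eq_mul, ← mul_assoc, ENNReal.inv_mul_cancel, one_mul]
    · rfl
    · exact_mod_cast n.factorial_ne_zero
    · exact ENNReal.natCast_ne_top _
  · have : IsEmpty (Fin k ↪ Fin n) := by
      rw [← Fintype.card_eq_zero_iff, Fintype.card_embedding_eq]
      simpa using hk
    have h0 : ∀ z : Fin k → ℂ, (Matrix.of fun i j => gramKernel Q n (z i) (z j)).det = 0 :=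
      det_kernelMatrix_gramKernel_eq_zero hk
    simp [h0]

/-! ### Change of scale -/

/-- Multiplication by `a`, as a real-linear map of the plane, has determinant `|a|²`. -/
theorem map_affine_dA {a : ℂ} (ha : a ≠ 0) (p : ℂ) :
    dA.map (fun ζ => a * (ζ - p)) = ENNReal.ofReal (‖a‖ ^ 2)⁻¹ • dA := by
  have h1 : (volume : Measure ℂ).map (fun ζ => ζ - p) = volume :=
    (measurePreserving_sub_right volume p).map_eq
  have hdet : LinearMap.det (Algebra.lmul ℝ ℂ a) = ‖a‖ ^ 2 := by
    rw [← Algebra.norm_apply, Algebra.norm_complex_apply, Complex.normSq_eq_norm_sq]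
  have h2 : (volume : Measure ℂ).map (fun ζ => a * ζ) =
      ENNReal.ofReal (‖a‖ ^ 2)⁻¹ • volume := by
    have h := Measure.map_linearMap_addHaar_eq_smul_addHaar (volume : Measure ℂ)
      (f := Algebra.lmul ℝ ℂ a) (by rw [hdet]; positivity)
    rw [hdet, abs_of_nonneg (by positivity)] at h
    exact h
  have h3 : (fun ζ => a * (ζ - p)) = (fun ζ => a * ζ) ∘ fun ζ => ζ - p := rfl
  rw [dA, Measure.map_smul, h3, ← Measure.map_map (by fun_prop) (by fun_prop), h1, h2,
    smul_comm]

theorem map_affine_dV {a : ℂ} (ha : a ≠ 0) (p : ℂ) (k : ℕ) :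
    (dV k).map (fun ζ i => a * (ζ i - p)) = ENNReal.ofReal (‖a‖ ^ 2)⁻¹ ^ k • dV k := by
  have hs : SigmaFinite (dA.map (fun ζ => a * (ζ - p))) := by
    rw [map_affine_dA ha]
    exact inferInstanceAs (SigmaFinite (((‖a‖ ^ 2)⁻¹).toNNReal • dA))
  rw [dV, Measure.pi_map_pi (f := fun _ ζ => a * (ζ - p)) (hμ := fun _ => hs)
    fun _ => by fun_prop]
  refine Measure.pi_eq fun s _ => ?_
  rw [Measure.smul_apply, Measure.pi_pi, map_affine_dA ha]
  simp [Finset.prod_mul_distrib]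

/-- The Jacobian of the `k` variables is compensated by the factor `|a|^{-2k}` that the `k × k`
determinant acquires from rescaling its entries. -/
theorem IsCorrelationKernel.affine {P : Measure (Fin n → ℂ)} {K K' : ℂ → ℂ → ℂ}
    (h : IsCorrelationKernel P K) {a : ℂ} (ha : a ≠ 0) (p : ℂ)
    (hK' : ∀ ζ η, K' (a * (ζ - p)) (a * (η - p)) = K ζ η / ((‖a‖ ^ 2 : ℝ) : ℂ))
    (hm : Measurable fun x : ℂ × ℂ => K' x.1 x.2) :
    IsCorrelationKernel (P.map fun ζ j => a * (ζ j - p)) K' := by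
  have hsurj : ∀ z, ∃ ζ, z = a * (ζ - p) := fun z => ⟨z / a + p, by field_simp; ring⟩
  have hdet : ∀ (k : ℕ) (ζ : Fin k → ℂ),
      (Matrix.of fun i j => K' (a * (ζ i - p)) (a * (ζ j - p))).det.re =
        (‖a‖ ^ 2)⁻¹ ^ k * (Matrix.of fun i j => K (ζ i) (ζ j)).det.re := by
    intro k ζ
    have : (Matrix.of fun i j => K' (a * (ζ i - p)) (a * (ζ j - p))) =
        (((‖a‖ ^ 2)⁻¹ : ℝ) : ℂ) • (Matrix.of fun i j => K (ζ i) (ζ j)) := by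
      ext i j
      simp [hK', div_eq_inv_mul]
    rw [this, Matrix.det_smul, Fintype.card_fin, ← Complex.ofReal_pow, Complex.re_ofReal_mul]
  refine ⟨fun z w => ?_, fun k => ⟨fun z => ?_, fun f hf => ?_⟩⟩
  · obtain ⟨ζ, rfl⟩ := hsurj z
    obtain ⟨η, rfl⟩ := hsurj w
    rw [hK', hK', h.1 ζ η, map_div₀, Complex.conj_ofReal]
  · choose ζ hζ using fun i => hsurj (z i)
    simp only [hζ, hdet]
    exact mul_nonneg (by positivity) ((h.2 k).1 ζ)
  · have hmT : ∀ m : ℕ, Measurable fun (ζ : Fin m → ℂ) j => a * (ζ j - p) := fun m => by fun_prop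
    have hm1 : Measurable fun ζ : Fin n → ℂ => ∑ e : Fin k ↪ Fin n, f (fun i => ζ (e i)) :=
      Finset.measurable_fun_sum _ fun e _ =>
        hf.comp (measurable_pi_lambda _ fun i => measurable_pi_apply _)
    have hm2 : Measurable fun z : Fin k → ℂ =>
        f z * ENNReal.ofReal (Matrix.of fun i j => K' (z i) (z j)).det.re := by
      refine hf.fun_mul (ENNReal.measurable_ofReal.comp (Complex.measurable_re.comp ?_))
      simp only [Matrix.det_apply', Matrix.of_apply]
      exact Finset.measurable_fun_sum _ fun σ _ => (Finset.measurable_fun_prod _ fun i _ =>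
        hm.comp (f := fun z : Fin k → ℂ => (z (σ i), z i)) (by fun_prop)).const_mul _
    rw [lintegral_map hm1 (hmT n), (h.2 k).2 (fun ζ => f (fun i => a * (ζ i - p)))
      (hf.comp (hmT k))]
    have hr : 0 < (‖a‖ ^ 2)⁻¹ := by positivity
    have hc0 : ENNReal.ofReal (‖a‖ ^ 2)⁻¹ ^ k ≠ 0 := pow_ne_zero _ (by simpa using ha)
    have hct : ENNReal.ofReal (‖a‖ ^ 2)⁻¹ ^ k ≠ ⊤ := ENNReal.pow_ne_top ENNReal.ofReal_ne_top
    -- Multiplying both sides by the Jacobian constant makes the reference measure on the right the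
    -- image of `dV k` under the affine map.
    refine (ENNReal.mul_right_inj hc0 hct).1 ?_
    rw [← smul_eq_mul (_ ^ k) (∫⁻ z, _ ∂dV k), ← smul_eq_mul (_ ^ k) (∫⁻ z, _ ∂dV k),
      ← lintegral_smul_measure _ (fun z : Fin k → ℂ =>
        f z * ENNReal.ofReal (Matrix.of fun i j => K' (z i) (z j)).det.re),
      ← map_affine_dV ha p, lintegral_map hm2 (hmT k), smul_eq_mul,
      ← lintegral_const_mul' _ _ hct]
    refine lintegral_congr fun ζ => ?_
    rw [hdet, ENNReal.ofReal_mul (by positivity), ENNReal.ofReal_pow hr.le]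
    ring

end

/-! ### Locally bounded families of entire functions -/

section Entire

variable {E : Type*} [NormedAddCommGroup E] [NormedSpace ℂ E]

/-- Cauchy's estimate on the complex line through `x` in direction `v`: the parameter disc of radius
`1 / ‖v‖` stays in the unit ball around `x`. -/
theorem norm_fderiv_le_of_norm_le {f : E → ℂ} (hf : Differentiable ℂ f) {x : E} {C : ℝ}
    (hC : ∀ y ∈ Metric.closedBall x 1, ‖f y‖ ≤ C) : ‖fderiv ℂ f x‖ ≤ C := by
  have hC0 : 0 ≤ C := (norm_nonneg _).trans (hC x (by simp))
  refine ContinuousLinearMap.opNorm_le_bound _ hC0 fun v => ?_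
  rcases eq_or_ne v 0 with rfl | hv
  · simp
  have hv' : 0 < ‖v‖ := norm_pos_iff.2 hv
  have hl : HasDerivAt (fun t : ℂ => x + t • v) v 0 := by
    simpa using ((hasDerivAt_id (0 : ℂ)).smul_const v).const_add x
  have hd : HasDerivAt (fun t : ℂ => f (x + t • v)) (fderiv ℂ f x v) 0 := by
    have h1 : HasFDerivAt f (fderiv ℂ f x) (x + (0 : ℂ) • v) := by
      simpa using (hf x).hasFDerivAt
    exact h1.comp_hasDerivAt 0 hl
  have hg : Differentiable ℂ fun t : ℂ => f (x + t • v) := by fun_prop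
  have h := Complex.norm_deriv_le_of_forall_mem_sphere_norm_le (c := 0) (R := ‖v‖⁻¹) (C := C)
    (inv_pos.2 hv') hg.diffContOnCl fun t ht => hC _ (by
      have : ‖t‖ = ‖v‖⁻¹ := by simpa using ht
      simp [norm_smul, this, hv'.ne'])
  rw [hd.deriv, div_inv_eq_mul] at h
  exact h

/-- Cauchy's estimate applied to `F m - F n` shows that the derivatives are uniformly Cauchy on a
unit ball, given uniform convergence on the ball of radius `2`. -/
theorem differentiable_of_tendsto_on_compacts [ProperSpace E] {F : ℕ → E → ℂ} {g : E → ℂ}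
    (hF : ∀ n, Differentiable ℂ (F n))
    (h : ∀ C, IsCompact C → TendstoUniformlyOn F g atTop C) : Differentiable ℂ g := by
  intro x
  have hcauchy : UniformCauchySeqOn (fun n => fderiv ℂ (F n)) atTop (Metric.ball x 1) := by
    have h1 := (h _ (isCompact_closedBall x 2)).uniformCauchySeqOn
    rw [Metric.uniformCauchySeqOn_iff] at h1 ⊢
    intro ε hε
    obtain ⟨N, hN⟩ := h1 (ε / 2) (half_pos hε)
    refine ⟨N, fun m hm n hn y hy => ?_⟩
    rw [dist_eq_norm, ← fderiv_sub (hF m y) (hF n y)]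
    refine (norm_fderiv_le_of_norm_le ((hF m).sub (hF n)) (C := ε / 2) fun u hu => ?_).trans_lt
      (half_lt_self hε)
    have hu2 : u ∈ Metric.closedBall x 2 := by
      have h3 := Metric.mem_closedBall.1 hu
      have h4 := Metric.mem_ball.1 hy
      rw [Metric.mem_closedBall]
      linarith [dist_triangle u y x]
    have h2 := hN m hm n hn u hu2
    rw [dist_eq_norm] at h2
    exact h2.le
  have hlim : ∀ y, ∃ A, y ∈ Metric.ball x 1 → Tendsto (fun n => fderiv ℂ (F n) y) atTop (𝓝 A) := by
    intro y
    by_cases hy : y ∈ Metric.ball x 1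
    · obtain ⟨A, hA⟩ := cauchySeq_tendsto_of_complete (hcauchy.cauchySeq hy)
      exact ⟨A, fun _ => hA⟩
    · exact ⟨0, fun h => absurd h hy⟩
  choose A hA using hlim
  have hunif := hcauchy.tendstoUniformlyOn_of_tendsto (fun y hy => hA y hy)
  refine (hasFDerivAt_of_tendstoUniformlyOn Metric.isOpen_ball hunif
    (fun n y _ => (hF n y).hasFDerivAt) (fun y _ => ?_)
    (Metric.mem_ball_self one_pos)).differentiableAt
  exact (h _ isCompact_singleton).tendsto_at (Set.mem_singleton y)

/-- Montel's theorem for sequences of entire functions. -/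
theorem exists_subseq_tendsto_on_compacts [ProperSpace E] {F : ℕ → E → ℂ}
    (hF : ∀ n, Differentiable ℂ (F n))
    (hb : ∀ R : ℝ, ∃ C : ℝ, ∀ᶠ n in atTop, ∀ x, ‖x‖ ≤ R → ‖F n x‖ ≤ C) :
    ∃ ψ : ℕ → ℕ, StrictMono ψ ∧ ∃ g : E → ℂ,
      ∀ C, IsCompact C → TendstoUniformlyOn (fun j => F (ψ j)) g atTop C := by
  -- The finitely many exceptional indices are bounded individually, each by continuity on a compact
  -- ball.
  have hb' : ∀ R : ℝ, ∃ C : ℝ, ∀ n x, ‖x‖ ≤ R → ‖F n x‖ ≤ C := by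
    intro R
    obtain ⟨C, hC⟩ := hb R
    obtain ⟨N, hN⟩ := eventually_atTop.1 hC
    have h1 : ∀ n, ∃ B : ℝ, ∀ x, ‖x‖ ≤ R → ‖F n x‖ ≤ B := by
      intro n
      obtain ⟨B, hB⟩ := (isCompact_closedBall (0 : E) R).exists_bound_of_continuousOn
        (hF n).continuous.continuousOn
      exact ⟨B, fun x hx => hB x (by simpa using hx)⟩
    choose B hB using h1
    refine ⟨|C| + ∑ n ∈ Finset.range N, |B n|, fun n x hx => ?_⟩
    rcases le_or_gt N n with hn | hn
    · exact (hN n hn x hx).trans ((le_abs_self C).trans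
        (le_add_of_nonneg_right (Finset.sum_nonneg fun _ _ => abs_nonneg _)))
    · refine (hB n x hx).trans ((le_abs_self _).trans ?_)
      exact (Finset.single_le_sum (f := fun n => |B n|) (fun _ _ => abs_nonneg _)
        (Finset.mem_range.2 hn)).trans (le_add_of_nonneg_left (abs_nonneg C))
  let Φ : ℕ → C(E, ℂ) := fun n => ⟨F n, (hF n).continuous⟩
  have hequi : ∀ x, EquicontinuousAt F x := by
    intro x
    -- Cauchy's estimate at points of the unit ball around `x` uses values within distance `2` of
    -- `x`; the resulting Lipschitz constant is common to all `n`.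
    obtain ⟨C, hC⟩ := hb' (‖x‖ + 2)
    refine Metric.equicontinuousAt_of_continuity_modulus (fun y => C * ‖x - y‖) ?_ F ?_
    · have : Continuous fun y => C * ‖x - y‖ := by fun_prop
      simpa using this.tendsto x
    · filter_upwards [Metric.ball_mem_nhds x one_pos] with y hy n
      rw [dist_eq_norm]
      refine (convex_ball x 1).norm_image_sub_le_of_norm_fderiv_le (𝕜 := ℂ)
        (fun u _ => hF n u) (fun u hu => norm_fderiv_le_of_norm_le (hF n) fun v hv => ?_) hy
        (Metric.mem_ball_self one_pos)
      refine hC n v ?_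
      have h3 := Metric.mem_closedBall.1 hv
      have h4 := Metric.mem_ball.1 hu
      have h5 := dist_triangle v u x
      rw [dist_eq_norm v x] at h5
      linarith [norm_le_norm_add_norm_sub' v x]
  have : T2Space (UniformOnFun E ℂ {K : Set E | IsCompact K}) :=
    UniformOnFun.t2Space_of_covering
      (Set.eq_univ_of_forall fun x => Set.mem_sUnion_of_mem (Set.mem_singleton x)
        isCompact_singleton)
  have hemb : IsClosedEmbedding
      (UniformOnFun.ofFun {K : Set E | IsCompact K} ∘ (fun f : C(E, ℂ) => (f : E → ℂ))) :=
    ContinuousMap.isUniformEmbedding_toUniformOnFunIsCompact.isClosedEmbedding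
  have hcomp : IsCompact (closure (Set.range Φ)) := by
    refine ArzelaAscoli.isCompact_closure_of_isClosedEmbedding (fun K hK => hK) hemb ?_ ?_
    · intro K _ x _
      have h1 : EquicontinuousAt
          ((fun f : C(E, ℂ) => (f : E → ℂ)) ∘ (Subtype.val : Set.range Φ → C(E, ℂ))) x := by
        intro U hU
        filter_upwards [hequi x U hU] with y hy
        rintro ⟨_, n, rfl⟩
        exact hy n
      exact h1.equicontinuousWithinAt K
    · intro K _ x _
      obtain ⟨C, hC⟩ := hb' ‖x‖
      refine ⟨Metric.closedBall 0 C, isCompact_closedBall 0 C, ?_⟩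
      rintro _ ⟨n, rfl⟩
      exact mem_closedBall_zero_iff.2 (hC n x le_rfl)
  obtain ⟨g, -, ψ, hψ, hg⟩ := hcomp.tendsto_subseq fun n => subset_closure (Set.mem_range_self n)
  refine ⟨ψ, hψ, g, fun C hC => ?_⟩
  exact ContinuousMap.tendsto_iff_forall_isCompact_tendstoUniformlyOn.1 hg C hC

end Entire

/-! ### Sub-mean value inequalities for the squared modulus -/

theorem norm_sq_le_circle_integral {f : ℂ → ℂ} (hf : Differentiable ℂ f) (r : ℝ) :
    ENNReal.ofReal (2 * Real.pi * ‖f 0‖ ^ 2) ≤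
      ∫⁻ t in Set.Ioo (-Real.pi) Real.pi, ENNReal.ofReal (‖f (circleMap 0 r t)‖ ^ 2) := by
  have hc : Continuous fun t => f (circleMap 0 r t) := hf.continuous.comp (continuous_circleMap 0 r)
  -- The mean value property is applied to the entire function `f²`; the triangle inequality then
  -- gives the estimate for `|f|²`.
  have hmean := (hf.pow 2).diffContOnCl.circleAverage (c := 0) (R := r)
  have hpi := Real.pi_pos
  have hmass : IntegrableOn (fun t => ‖f (circleMap 0 r t)‖ ^ 2) (Set.Ioo (-Real.pi) Real.pi) :=
    ((hc.norm.pow 2).continuousOn.integrableOn_Icc).mono_set Set.Ioo_subset_Icc_self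
  rw [← ofReal_integral_eq_lintegral_ofReal hmass (ae_of_all _ fun _ => sq_nonneg _)]
  refine ENNReal.ofReal_le_ofReal ?_
  have hper : Function.Periodic (fun t => ‖f (circleMap 0 r t)‖ ^ 2) (2 * Real.pi) := fun t => by
    simp only [periodic_circleMap 0 r t]
  have h1 := hper.intervalIntegral_add_eq (-Real.pi) 0
  rw [show -Real.pi + 2 * Real.pi = Real.pi by ring, zero_add] at h1
  rw [← integral_Ioc_eq_integral_Ioo, ← intervalIntegral.integral_of_le (by linarith), h1]
  have h2 : (2 * Real.pi) * ‖f 0‖ ^ 2 = ‖∫ t in (0 : ℝ)..2 * Real.pi, f (circleMap 0 r t) ^ 2‖ := by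
    rw [Real.circleAverage_def] at hmean
    simp only [Pi.pow_apply] at hmean
    rw [← norm_pow, ← hmean, norm_smul, Real.norm_of_nonneg (by positivity)]
    field_simp
  rw [h2]
  refine (intervalIntegral.norm_integral_le_integral_norm (by linarith)).trans_eq ?_
  simp only [norm_pow]

theorem norm_sq_le_lintegral_ball_zero {f : ℂ → ℂ} (hf : Differentiable ℂ f) :
    ENNReal.ofReal (‖f 0‖ ^ 2) ≤
      ∫⁻ z in Metric.ball 0 1, ENNReal.ofReal (‖f z‖ ^ 2) ∂dA := by
  have hpi := Real.pi_pos
  rw [dA, Measure.restrict_smul, lintegral_smul_measure, ← lintegral_indicator measurableSet_ball,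
    ← Complex.lintegral_comp_polarCoord_symm, polarCoord_target, Measure.volume_eq_prod,
    ← Measure.prod_restrict, lintegral_prod]
  · have h1 : ∀ r ∈ Set.Ioo (0 : ℝ) 1, ENNReal.ofReal r * ENNReal.ofReal (2 * Real.pi * ‖f 0‖ ^ 2) ≤
        ∫⁻ t in Set.Ioo (-Real.pi) Real.pi, ENNReal.ofReal r •
          (Metric.ball (0 : ℂ) 1).indicator (fun z => ENNReal.ofReal (‖f z‖ ^ 2))
            (Complex.polarCoord.symm (r, t)) := by
      intro r hr
      have h2 : ∀ t, Complex.polarCoord.symm (r, t) = circleMap 0 r t := fun t => by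
        simp [circleMap, Complex.exp_mul_I]
      have h3 : ∀ t, circleMap 0 r t ∈ Metric.ball (0 : ℂ) 1 := fun t => by
        simpa [abs_of_pos hr.1] using hr.2
      simp only [h2, Set.indicator_of_mem (h3 _), smul_eq_mul]
      rw [lintegral_const_mul' _ _ ENNReal.ofReal_ne_top]
      exact mul_le_mul_right (norm_sq_le_circle_integral hf r) _
    -- With `dA = d²z / π` the constants give `π⁻¹ · (1/2) · 2π = 1`.
    have h4 : ∫⁻ r in Set.Ioo (0 : ℝ) 1, ENNReal.ofReal r = ENNReal.ofReal (1 / 2) := by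
      rw [← ofReal_integral_eq_lintegral_ofReal, ← integral_Ioc_eq_integral_Ioo,
        ← intervalIntegral.integral_of_le zero_le_one, integral_id]
      · norm_num
      · exact (continuous_id.continuousOn.integrableOn_Icc).mono_set Set.Ioo_subset_Icc_self
      · filter_upwards [ae_restrict_mem measurableSet_Ioo] with r hr using hr.1.le
    calc ENNReal.ofReal (‖f 0‖ ^ 2) = ENNReal.ofReal Real.pi⁻¹ *
          ∫⁻ r in Set.Ioo (0 : ℝ) 1,
            ENNReal.ofReal r * ENNReal.ofReal (2 * Real.pi * ‖f 0‖ ^ 2) := by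
          rw [lintegral_mul_const' _ _ ENNReal.ofReal_ne_top, h4,
            ← ENNReal.ofReal_mul (by norm_num), ← ENNReal.ofReal_mul (by positivity)]
          congr 1
          field_simp
      _ ≤ _ := by
          rw [smul_eq_mul]
          refine mul_le_mul_right ?_ _
          refine (setLIntegral_mono' measurableSet_Ioo h1).trans ?_
          exact lintegral_mono_set Set.Ioo_subset_Ioi_self
  · refine Measurable.aemeasurable ?_
    have hm : Measurable fun z => ENNReal.ofReal (‖f z‖ ^ 2) :=
      (ENNReal.continuous_ofReal.comp (hf.continuous.norm.pow 2)).measurable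
    have hs : Measurable fun p : ℝ × ℝ => Complex.polarCoord.symm p := by
      simp only [Complex.polarCoord_symm_apply]
      fun_prop
    exact (ENNReal.measurable_ofReal.comp measurable_fst).smul
      ((hm.indicator measurableSet_ball).comp hs)

/-- The area sub-mean value inequality for the square modulus of an entire function. -/
theorem norm_sq_le_lintegral_ball {f : ℂ → ℂ} (hf : Differentiable ℂ f) (z₀ : ℂ) :
    ENNReal.ofReal (‖f z₀‖ ^ 2) ≤
      ∫⁻ z in Metric.ball z₀ 1, ENNReal.ofReal (‖f z‖ ^ 2) ∂dA := by
  have h := norm_sq_le_lintegral_ball_zero (f := fun z => f (z + z₀)) (by fun_prop)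
  have hmp : MeasurePreserving (fun z : ℂ => z + z₀) dA dA := by
    refine ⟨by fun_prop, ?_⟩
    rw [dA, Measure.map_smul, (measurePreserving_add_right volume z₀).map_eq]
  have hpre : (fun z : ℂ => z + z₀) ⁻¹' Metric.ball z₀ 1 = Metric.ball 0 1 := by
    ext z
    simp [dist_eq_norm]
  have hm : Measurable fun z => ENNReal.ofReal (‖f z‖ ^ 2) :=
    (ENNReal.continuous_ofReal.comp (hf.continuous.norm.pow 2)).measurable
  have h2 := hmp.setLIntegral_comp_preimage (s := Metric.ball z₀ 1) measurableSet_ball hm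
  rw [hpre] at h2
  rw [← h2]
  simpa using h

/-! ### Limits of kernels that factor through Hermitian-entire functions -/

theorem norm_ginibre_sq (z w : ℂ) : ‖ginibre z w‖ ^ 2 = Real.exp (-‖z - w‖ ^ 2) := by
  rw [ginibre, Complex.norm_exp, ← Real.exp_nat_mul]
  congr 1
  rw [← Complex.normSq_eq_norm_sq, ← Complex.normSq_eq_norm_sq, ← Complex.normSq_eq_norm_sq]
  simp [Complex.normSq_apply]
  ring

theorem ginibre_self (z : ℂ) : ginibre z z = 1 := by
  rw [ginibre, Complex.mul_conj', ← Complex.ofReal_pow, ← Complex.ofReal_sub,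
    ← Complex.ofReal_sub]
  ring_nf
  simp

/-- Hermitian kernels `F_n(z, w) = L_n(z, w) E_n(z) E_n(w)` with the mass-one property, where `L_n`
is entire in `z` and `w̄`, and `E_n → e^{-|z|²/2}` locally uniformly. -/
structure IsGaussianFactorization (F L : ℕ → ℂ → ℂ → ℂ) (E : ℕ → ℂ → ℝ) : Prop where
  eq : ∀ n z w, F n z w = L n z w * E n z * E n w
  entire : ∀ n, Differentiable ℂ fun x : ℂ × ℂ => L n x.1 (conj x.2)
  hermitian : ∀ n z w, F n z w = conj (F n w z)
  integrable : ∀ n z, Integrable (fun w => ‖F n z w‖ ^ 2) dA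
  mass : ∀ n z, ∫ w, ‖F n z w‖ ^ 2 ∂dA = (F n z z).re
  lim : ∀ R : ℝ, TendstoUniformlyOn E (fun z => Real.exp (-‖z‖ ^ 2 / 2)) atTop
    (Metric.closedBall 0 R)

namespace IsGaussianFactorization

variable {F L : ℕ → ℂ → ℂ → ℂ} {E : ℕ → ℂ → ℝ}

theorem subseq (h : IsGaussianFactorization F L E) {φ : ℕ → ℕ} (hφ : StrictMono φ) :
    IsGaussianFactorization (fun j => F (φ j)) (fun j => L (φ j)) (fun j => E (φ j)) where
  eq n := h.eq _
  entire n := h.entire _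
  hermitian n := h.hermitian _
  integrable n := h.integrable _
  mass n := h.mass _
  lim R := by
    intro u hu
    exact hφ.tendsto_atTop.eventually (h.lim R u hu)

theorem norm_comm (h : IsGaussianFactorization F L E) (n : ℕ) (z w : ℂ) :
    ‖F n z w‖ = ‖F n w z‖ := by
  rw [h.hermitian, Complex.norm_conj]

theorem eventually_bounds (h : IsGaussianFactorization F L E) (R : ℝ) :
    ∃ m : ℝ, 0 < m ∧ ∀ᶠ n in atTop, ∀ z, ‖z‖ ≤ R → m ≤ E n z ∧ E n z ≤ 2 := by
  have hm : 0 < Real.exp (-R ^ 2 / 2) := Real.exp_pos _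
  -- On the disc the limit lies between `e^{-R²/2}` and `1`. The tolerance keeps `E n` above half
  -- the lower value and below `2`.
  have h1 := Metric.tendstoUniformlyOn_iff.1 (h.lim R) (min (Real.exp (-R ^ 2 / 2) / 2) 1)
    (by positivity)
  refine ⟨Real.exp (-R ^ 2 / 2) / 2, by positivity, ?_⟩
  filter_upwards [h1] with n hn z hz
  have h2 := hn z (by simpa using hz)
  rw [Real.dist_eq, lt_min_iff, abs_lt, abs_lt] at h2
  have h3 : Real.exp (-R ^ 2 / 2) ≤ Real.exp (-‖z‖ ^ 2 / 2) := by
    refine Real.exp_le_exp.2 ?_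
    have := pow_le_pow_left₀ (norm_nonneg z) hz 2
    linarith
  have h4 : Real.exp (-‖z‖ ^ 2 / 2) ≤ 1 := by
    rw [Real.exp_le_one_iff]
    have := sq_nonneg ‖z‖
    linarith
  constructor <;> linarith

/-- The sub-mean value inequality bounds the left side by the integral of `|L(·, w)|²` over a unit
disc. There `|L|² ≤ m⁻⁴ |F|²`, and the total mass of `|F(w, ·)|²` is `F(w, w) ≤ 4 |L(w, w)|`. The
estimate is useful because its right side has the lower power of `L`. -/
theorem norm_sq_le (h : IsGaussianFactorization F L E) {n : ℕ} {R m : ℝ} (hm : 0 < m)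
    (hE : ∀ z, ‖z‖ ≤ R + 1 → m ≤ E n z ∧ E n z ≤ 2) {z w : ℂ} (hz : ‖z‖ ≤ R) (hw : ‖w‖ ≤ R) :
    ‖L n z w‖ ^ 2 ≤ 4 / m ^ 4 * ‖L n w w‖ := by
  have hd : Differentiable ℂ fun u => L n u w := by
    have : Differentiable ℂ fun u : ℂ => (u, conj w) := by fun_prop
    simpa [Function.comp_def] using (h.entire n).comp this
  have hEw := hE w (by linarith)
  have hEw0 : 0 < E n w := hm.trans_le hEw.1
  have h1 : ∀ u ∈ Metric.ball z 1, ENNReal.ofReal (‖L n u w‖ ^ 2) ≤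
      ENNReal.ofReal (1 / m ^ 4) * ENNReal.ofReal (‖F n w u‖ ^ 2) := by
    intro u hu
    rw [← ENNReal.ofReal_mul (by positivity)]
    refine ENNReal.ofReal_le_ofReal ?_
    have hu' : ‖u‖ ≤ R + 1 := by
      have := Metric.mem_ball.1 hu
      rw [dist_eq_norm] at this
      linarith [norm_le_norm_add_norm_sub' u z]
    have hEu := hE u hu'
    have hEu0 : 0 < E n u := hm.trans_le hEu.1
    rw [h.norm_comm, h.eq, norm_mul, norm_mul, Complex.norm_real, Complex.norm_real,
      Real.norm_of_nonneg hEu0.le, Real.norm_of_nonneg hEw0.le, div_mul_eq_mul_div, one_mul,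
      le_div_iff₀ (by positivity)]
    have h2 : m ^ 2 ≤ E n u * E n w := by
      rw [sq]
      exact mul_le_mul hEu.1 hEw.1 hm.le hEu0.le
    calc ‖L n u w‖ ^ 2 * m ^ 4 = (‖L n u w‖ * m ^ 2) ^ 2 := by ring
      _ ≤ (‖L n u w‖ * (E n u * E n w)) ^ 2 := by gcongr
      _ = _ := by ring
  have h3 : ENNReal.ofReal (‖L n z w‖ ^ 2) ≤ ENNReal.ofReal (1 / m ^ 4 * (F n w w).re) := by
    calc _ ≤ ∫⁻ u in Metric.ball z 1, ENNReal.ofReal (‖L n u w‖ ^ 2) ∂dA :=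
          norm_sq_le_lintegral_ball hd z
      _ ≤ ∫⁻ u in Metric.ball z 1,
            ENNReal.ofReal (1 / m ^ 4) * ENNReal.ofReal (‖F n w u‖ ^ 2) ∂dA :=
          setLIntegral_mono' measurableSet_ball h1
      _ ≤ ∫⁻ u, ENNReal.ofReal (1 / m ^ 4) * ENNReal.ofReal (‖F n w u‖ ^ 2) ∂dA :=
          setLIntegral_le_lintegral _ _
      _ = _ := by
          rw [lintegral_const_mul' _ _ ENNReal.ofReal_ne_top,
            ← ofReal_integral_eq_lintegral_ofReal (h.integrable n w)
              (ae_of_all _ fun _ => sq_nonneg _), h.mass, ENNReal.ofReal_mul (by positivity)]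
  have h4 : (F n w w).re ≤ 4 * ‖L n w w‖ := by
    refine (Complex.re_le_norm _).trans ?_
    rw [h.eq, norm_mul, norm_mul, Complex.norm_real, Real.norm_of_nonneg hEw0.le, mul_assoc,
      mul_comm]
    refine mul_le_mul_of_nonneg_right ?_ (norm_nonneg _)
    nlinarith [hEw.2]
  have h5 : 0 ≤ (F n w w).re := by
    rw [← h.mass]
    exact integral_nonneg fun _ => sq_nonneg _
  rw [ENNReal.ofReal_le_ofReal_iff (by positivity)] at h3
  refine h3.trans ?_
  calc _ ≤ 1 / m ^ 4 * (4 * ‖L n w w‖) := by gcongr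
    _ = _ := by ring

/-- On the diagonal the preceding estimate reads `x² ≤ A x`, hence `x ≤ A`; inserting this bound
gives the same constant off the diagonal. -/
theorem eventually_norm_le (h : IsGaussianFactorization F L E) (R : ℝ) :
    ∃ C : ℝ, ∀ᶠ n in atTop, ∀ z w, ‖z‖ ≤ R → ‖w‖ ≤ R → ‖L n z w‖ ≤ C := by
  obtain ⟨m, hm, hE⟩ := h.eventually_bounds (R + 1)
  refine ⟨4 / m ^ 4, ?_⟩
  filter_upwards [hE] with n hn z w hz hw
  have hA : 0 < 4 / m ^ 4 := by positivity
  have h1 : ‖L n w w‖ ≤ 4 / m ^ 4 := by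
    have := h.norm_sq_le hm hn hw hw
    by_contra hlt
    nlinarith [norm_nonneg (L n w w)]
  have h2 := h.norm_sq_le hm hn hz hw
  refine abs_le_of_sq_le_sq' ?_ hA.le |>.2
  calc _ ≤ _ := h2
    _ ≤ 4 / m ^ 4 * (4 / m ^ 4) := by gcongr
    _ = _ := by ring

theorem exists_subseq (h : IsGaussianFactorization F L E) :
    ∃ ψ : ℕ → ℕ, StrictMono ψ ∧ ∃ g : ℂ × ℂ → ℂ, Differentiable ℂ g ∧
      TendstoOnCompacts (fun j => F (ψ j)) fun z w => g (z, conj w) *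
        (Real.exp (-‖z‖ ^ 2 / 2) : ℂ) * (Real.exp (-‖w‖ ^ 2 / 2) : ℂ) := by
  obtain ⟨ψ, hψ, g, hg⟩ := exists_subseq_tendsto_on_compacts h.entire (fun R => by
    obtain ⟨C, hC⟩ := h.eventually_norm_le R
    refine ⟨C, ?_⟩
    filter_upwards [hC] with n hn x hx
    refine hn _ _ ((norm_fst_le x).trans hx) ?_
    rw [Complex.norm_conj]
    exact (norm_snd_le x).trans hx)
  have hgd := differentiable_of_tendsto_on_compacts (fun j => h.entire (ψ j)) hg
  refine ⟨ψ, hψ, g, hgd, fun C hC => ?_⟩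
  have hconj : Continuous fun x : ℂ × ℂ => (x.1, conj x.2) :=
    continuous_fst.prodMk (Complex.continuous_conj.comp continuous_snd)
  have hL : TendstoLocallyUniformlyOn (fun j (x : ℂ × ℂ) => L (ψ j) x.1 x.2)
      (fun x => g (x.1, conj x.2)) atTop C := by
    refine TendstoUniformlyOn.tendstoLocallyUniformlyOn ?_
    have := (hg _ (hC.image hconj)).comp (fun x : ℂ × ℂ => (x.1, conj x.2))
    refine (this.mono (Set.subset_preimage_image _ _)).congr ?_
    exact Eventually.of_forall fun j x _ => by simp
  have hE : ∀ π : ℂ × ℂ → ℂ, Continuous π →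
      TendstoLocallyUniformlyOn (fun j (x : ℂ × ℂ) => (E (ψ j) (π x) : ℂ))
        (fun x => (Real.exp (-‖π x‖ ^ 2 / 2) : ℂ)) atTop C := by
    intro π hπ
    refine TendstoUniformlyOn.tendstoLocallyUniformlyOn ?_
    obtain ⟨R, hR⟩ := hC.exists_bound_of_continuousOn hπ.continuousOn
    have h1 := (((h.subseq hψ).lim R).comp π).mono
      (s' := C) fun x hx => by simpa using hR x hx
    rw [Metric.tendstoUniformlyOn_iff] at h1 ⊢
    intro ε hε
    filter_upwards [h1 ε hε] with j hj x hx
    rw [dist_eq_norm, ← Complex.ofReal_sub, Complex.norm_real, ← dist_eq_norm]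
    exact hj x hx
  have hc1 : Continuous fun x : ℂ × ℂ => (Real.exp (-‖x.1‖ ^ 2 / 2) : ℂ) := by fun_prop
  have hc2 : Continuous fun x : ℂ × ℂ => (Real.exp (-‖x.2‖ ^ 2 / 2) : ℂ) := by fun_prop
  have hcg : Continuous fun x : ℂ × ℂ => g (x.1, conj x.2) := hgd.continuous.comp hconj
  have hprod := (hL.fun_mul₀ (hE Prod.fst continuous_fst) hcg.continuousOn hc1.continuousOn).fun_mul₀
    (hE Prod.snd continuous_snd) (hcg.mul hc1).continuousOn hc2.continuousOn
  rw [tendstoLocallyUniformlyOn_iff_tendstoUniformlyOn_of_compact hC] at hprod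
  refine hprod.congr ?_
  exact Eventually.of_forall fun j x _ => (h.eq (ψ j) x.1 x.2).symm

/-- Montel's theorem only serves to identify the form of `K`: a further subsequence converges to a
factored limit, which must coincide with `K`. -/
theorem limit_eq (h : IsGaussianFactorization F L E) {K : ℂ → ℂ → ℂ}
    (hK : TendstoOnCompacts F K) :
    ∃ Ψ : ℂ → ℂ → ℂ, IsHermitianEntire Ψ ∧ (∀ z w, K z w = ginibre z w * Ψ z w) ∧
      MassOneInequality Ψ := by
  have hpt : ∀ z w, Tendsto (fun n => F n z w) atTop (𝓝 (K z w)) := fun z w =>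
    (hK _ isCompact_singleton).tendsto_at (Set.mem_singleton (z, w))
  obtain ⟨ψ, hψ, g, hgd, hg⟩ := h.exists_subseq
  have hKg : ∀ z w, K z w = g (z, conj w) *
      (Real.exp (-‖z‖ ^ 2 / 2) : ℂ) * (Real.exp (-‖w‖ ^ 2 / 2) : ℂ) := fun z w =>
    tendsto_nhds_unique ((hpt z w).comp hψ.tendsto_atTop)
      ((hg _ isCompact_singleton).tendsto_at (Set.mem_singleton (z, w)))
  have hKherm : ∀ z w, K z w = conj (K w z) := fun z w => by
    refine tendsto_nhds_unique (hpt z w) ?_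
    simp only [h.hermitian _ z w]
    exact (Complex.continuous_conj.tendsto _).comp (hpt w z)
  -- Dividing by the factor `e^{z w̄}` of the Ginibre kernel keeps the function entire in `z` and
  -- `w̄`.
  let Ψ : ℂ → ℂ → ℂ := fun z w => g (z, conj w) * Complex.exp (-(z * conj w))
  have hKΨ : ∀ z w, K z w = ginibre z w * Ψ z w := by
    intro z w
    have h1 : ginibre z w * Complex.exp (-(z * conj w)) =
        (Real.exp (-‖z‖ ^ 2 / 2) : ℂ) * (Real.exp (-‖w‖ ^ 2 / 2) : ℂ) := by
      rw [ginibre, ← Complex.exp_add, Complex.ofReal_exp, Complex.ofReal_exp, ← Complex.exp_add]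
      congr 1
      push_cast
      ring
    calc K z w = g (z, conj w) *
          ((Real.exp (-‖z‖ ^ 2 / 2) : ℂ) * (Real.exp (-‖w‖ ^ 2 / 2) : ℂ)) := by
          rw [hKg, mul_assoc]
      _ = _ := by
          rw [← h1]
          ring
  have hg0 : ∀ z w, ginibre z w ≠ 0 := fun z w => Complex.exp_ne_zero _
  have hgherm : ∀ z w, ginibre z w = conj (ginibre w z) := fun z w => by
    simp only [ginibre, ← Complex.exp_conj, map_sub, map_mul, Complex.conj_conj,
      Complex.conj_ofReal]
    congr 1
    ring
  have hconj : Continuous fun x : ℂ × ℂ => (x.1, conj x.2) :=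
    continuous_fst.prodMk (Complex.continuous_conj.comp continuous_snd)
  have hΨc : Continuous fun x : ℂ × ℂ => Ψ x.1 x.2 :=
    (hgd.continuous.comp hconj).mul (Complex.continuous_exp.comp
      (continuous_fst.mul (Complex.continuous_conj.comp continuous_snd)).neg)
  have hΨherm : ∀ z w, Ψ z w = conj (Ψ w z) := fun z w => by
    have h1 := hKherm z w
    rw [hKΨ, hKΨ, map_mul, ← hgherm] at h1
    exact mul_left_cancel₀ (hg0 z w) h1
  refine ⟨Ψ, ⟨⟨hΨc, hΨherm⟩, ?_⟩, hKΨ, fun z => ?_⟩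
  · simp only [Ψ, Complex.conj_conj]
    fun_prop
  · have hnorm : ∀ w, Real.exp (-‖z - w‖ ^ 2) * ‖Ψ z w‖ ^ 2 = ‖K z w‖ ^ 2 := fun w => by
      rw [hKΨ, norm_mul (ginibre z w), mul_pow, norm_ginibre_sq]
    have hdiag : Ψ z z = K z z := by rw [hKΨ, ginibre_self, one_mul]
    simp only [hnorm, hdiag]
    -- Before the limit there is equality; Fatou's lemma retains only an inequality.
    have hfatou : ∫⁻ w, ENNReal.ofReal (‖K z w‖ ^ 2) ∂dA ≤ ENNReal.ofReal (K z z).re := by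
      have h1 : ∀ w, Tendsto (fun n => ENNReal.ofReal (‖F n z w‖ ^ 2)) atTop
          (𝓝 (ENNReal.ofReal (‖K z w‖ ^ 2))) := fun w =>
        ENNReal.tendsto_ofReal ((hpt z w).norm.pow 2)
      have h2 : Tendsto (fun n => ∫⁻ w, ENNReal.ofReal (‖F n z w‖ ^ 2) ∂dA) atTop
          (𝓝 (ENNReal.ofReal (K z z).re)) := by
        have h3 : ∀ n, ∫⁻ w, ENNReal.ofReal (‖F n z w‖ ^ 2) ∂dA =
            ENNReal.ofReal (F n z z).re := fun n => by
          rw [← ofReal_integral_eq_lintegral_ofReal (h.integrable n z)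
              (ae_of_all _ fun _ => sq_nonneg _), h.mass]
        simp only [h3]
        exact ENNReal.tendsto_ofReal ((Complex.continuous_re.tendsto _).comp (hpt z z))
      calc ∫⁻ w, ENNReal.ofReal (‖K z w‖ ^ 2) ∂dA
          = ∫⁻ w, liminf (fun n => ENNReal.ofReal (‖F n z w‖ ^ 2)) atTop ∂dA := by
            simp only [(h1 _).liminf_eq]
        _ ≤ liminf (fun n => ∫⁻ w, ENNReal.ofReal (‖F n z w‖ ^ 2) ∂dA) atTop :=
            lintegral_liminf_le' fun n => (h.integrable n z).1.aemeasurable.ennreal_ofReal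
        _ = _ := h2.liminf_eq
    have hmeas : AEStronglyMeasurable (fun w => ‖K z w‖ ^ 2) dA := by
      have : Continuous fun w => Real.exp (-‖z - w‖ ^ 2) * ‖Ψ z w‖ ^ 2 := by
        have : Continuous fun w => Ψ z w := hΨc.comp (Continuous.prodMk_right z)
        fun_prop
      simpa only [hnorm] using this.aestronglyMeasurable
    have hre : 0 ≤ (K z z).re := by
      refine ge_of_tendsto' ((Complex.continuous_re.tendsto _).comp (hpt z z)) fun n => ?_
      rw [Function.comp_apply, ← h.mass]
      exact integral_nonneg fun _ => sq_nonneg _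
    refine ⟨⟨hmeas, ?_⟩, ?_⟩
    · rw [hasFiniteIntegral_iff_ofReal (ae_of_all _ fun _ => sq_nonneg _)]
      exact hfatou.trans_lt ENNReal.ofReal_lt_top
    · rw [integral_eq_lintegral_of_nonneg_ae (ae_of_all _ fun _ => sq_nonneg _) hmeas]
      exact ENNReal.toReal_le_of_le_ofReal hre hfatou

end IsGaussianFactorization

/-! ### Second-order expansion of the potential -/

/-- Second-order Taylor expansion, uniform over a compact set of base points. -/
theorem exists_uniform_taylor_two {E : Type*} [NormedAddCommGroup E] [NormedSpace ℝ E]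
    [ProperSpace E] {f : E → ℝ} {U S : Set E} (hU : IsOpen U) (hf : ContDiffOn ℝ 2 f U)
    (hS : IsCompact S) (hSU : S ⊆ U) {ε : ℝ} (hε : 0 < ε) :
    ∃ δ > 0, ∀ p ∈ S, ∀ h : E, ‖h‖ ≤ δ → p + h ∈ U ∧
      |f (p + h) - f p - fderiv ℝ f p h - fderiv ℝ (fderiv ℝ f) p h h / 2| ≤ ε * ‖h‖ ^ 2 := by
  -- Segments from `p` to `p + h` stay in a compact thickening of `S`, where the second derivative
  -- is uniformly continuous; this makes `δ` independent of `p`.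
  obtain ⟨r, hr, hrU⟩ := hS.exists_cthickening_subset_open hU hSU
  have hf1 : ContDiffOn ℝ 1 (fderiv ℝ f) U := hf.fderiv_of_isOpen hU (by norm_num)
  have hf2 : ContinuousOn (fderiv ℝ (fderiv ℝ f)) U :=
    hf1.continuousOn_fderiv_of_isOpen hU (by norm_num)
  have hunif := hS.cthickening.uniformContinuousOn_of_continuous (hf2.mono hrU)
  obtain ⟨η, hη, hcont⟩ := (Metric.uniformContinuousOn_iff
    (f := fderiv ℝ (fderiv ℝ f)) (s := Metric.cthickening r S)).1 hunif ε hε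
  refine ⟨min r (η / 2), lt_min hr (half_pos hη), fun p hp h hh => ?_⟩
  have hmem : ∀ t ∈ Set.Icc (0 : ℝ) 1, p + t • h ∈ Metric.cthickening r S := by
    intro t ht
    refine Metric.mem_cthickening_of_dist_le _ p r S hp ?_
    rw [dist_self_add_left, norm_smul, Real.norm_of_nonneg ht.1]
    nlinarith [norm_nonneg h, ht.2, hh.trans (min_le_left _ _)]
  have hline : ∀ t : ℝ, HasDerivAt (fun t : ℝ => p + t • h) h t := fun t => by
    simpa using ((hasDerivAt_id t).smul_const h).const_add p
  have hd1 : ∀ t ∈ Set.Icc (0 : ℝ) 1,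
      HasDerivAt (fun t : ℝ => f (p + t • h)) (fderiv ℝ f (p + t • h) h) t := by
    intro t ht
    have h1 := ((hf.differentiableOn (by norm_num)).differentiableAt
      (hU.mem_nhds (hrU (hmem t ht)))).hasFDerivAt
    exact h1.comp_hasDerivAt t (hline t)
  have hd2 : ∀ t ∈ Set.Icc (0 : ℝ) 1, HasDerivAt (fun t : ℝ => fderiv ℝ f (p + t • h) h)
      (fderiv ℝ (fderiv ℝ f) (p + t • h) h h) t := by
    intro t ht
    have h1 := ((hf1.differentiableOn (by norm_num)).differentiableAt
      (hU.mem_nhds (hrU (hmem t ht)))).hasFDerivAt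
    exact (ContinuousLinearMap.apply ℝ ℝ h).hasFDerivAt.comp_hasDerivAt t
      (h1.comp_hasDerivAt t (hline t))
  set B := fderiv ℝ (fderiv ℝ f) p h h with hB
  have hbound : ∀ t ∈ Set.Icc (0 : ℝ) 1,
      ‖fderiv ℝ (fderiv ℝ f) (p + t • h) h h - B‖ ≤ ε * ‖h‖ ^ 2 := by
    intro t ht
    have h0 : p ∈ Metric.cthickening r S := by simpa using hmem 0 (by simp)
    have hdist : dist (p + t • h) p < η := by
      rw [dist_self_add_left, norm_smul, Real.norm_of_nonneg ht.1]
      nlinarith [norm_nonneg h, ht.2, hh.trans (min_le_right _ _)]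
    have h1 : ‖fderiv ℝ (fderiv ℝ f) (p + t • h) - fderiv ℝ (fderiv ℝ f) p‖ < ε :=
      (dist_eq_norm (E := E →L[ℝ] E →L[ℝ] ℝ) _ _).symm.trans_lt (hcont _ (hmem t ht) _ h0 hdist)
    calc _ = ‖(fderiv ℝ (fderiv ℝ f) (p + t • h) - fderiv ℝ (fderiv ℝ f) p) h h‖ := by
          simp [hB]
      _ ≤ ‖fderiv ℝ (fderiv ℝ f) (p + t • h) - fderiv ℝ (fderiv ℝ f) p‖ * ‖h‖ * ‖h‖ :=
          ContinuousLinearMap.le_opNorm₂ _ _ _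
      _ ≤ ε * ‖h‖ * ‖h‖ := by gcongr
      _ = _ := by ring
  -- The remainder is integrated twice along the segment by the mean value inequality, once here and
  -- once in `hfinal`.
  have hslope : ∀ t ∈ Set.Icc (0 : ℝ) 1,
      ‖fderiv ℝ f (p + t • h) h - fderiv ℝ f p h - t * B‖ ≤ ε * ‖h‖ ^ 2 := by
    intro t ht
    have h1 := norm_image_sub_le_of_norm_deriv_le_segment' (a := 0) (b := 1)
      (f := fun t : ℝ => fderiv ℝ f (p + t • h) h - t * B)
      (f' := fun t => fderiv ℝ (fderiv ℝ f) (p + t • h) h h - B) (C := ε * ‖h‖ ^ 2)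
      (fun t ht => by
        simpa using ((hd2 t ht).fun_sub ((hasDerivAt_id t).mul_const B)).hasDerivWithinAt)
      (fun t ht => hbound t ⟨ht.1, ht.2.le⟩) t ht
    have h2 : fderiv ℝ f (p + t • h) h - fderiv ℝ f p h - t * B =
        fderiv ℝ f (p + t • h) h - t * B -
          (fderiv ℝ f (p + (0 : ℝ) • h) h - 0 * B) := by
      simp
      ring
    rw [h2]
    refine h1.trans ?_
    have : 0 ≤ ε * ‖h‖ ^ 2 := by positivity
    nlinarith [ht.2]
  have hfinal := norm_image_sub_le_of_norm_deriv_le_segment_01'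
    (f := fun t : ℝ => f (p + t • h) - t * fderiv ℝ f p h - t ^ 2 * (B / 2))
    (f' := fun t => fderiv ℝ f (p + t • h) h - fderiv ℝ f p h - t * B) (C := ε * ‖h‖ ^ 2)
    (fun t ht => by
      have h1 := ((hd1 t ht).sub ((hasDerivAt_id t).mul_const (fderiv ℝ f p h))).sub
        ((hasDerivAt_pow 2 t).mul_const (B / 2))
      refine (h1.congr_deriv ?_).hasDerivWithinAt
      simp
      ring)
    (fun t ht => hslope t ⟨ht.1, ht.2.le⟩)
  refine ⟨by simpa using hrU (hmem 1 (by simp)), ?_⟩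
  rw [Real.norm_eq_abs] at hfinal
  convert hfinal using 2
  simp
  ring

/-- The coefficient `a` with `DQ(p) h = Re (a h)`. -/
def linCoeff (Q : ℂ → EReal) (p : ℂ) : ℂ :=
  ⟨fderiv ℝ (fun z => (Q z).toReal) p 1, -fderiv ℝ (fun z => (Q z).toReal) p Complex.I⟩

/-- The coefficient `b` with `D²Q(p)(h, h) / 2 = ΔQ(p) |h|² + Re (b h²)`. -/
def quadCoeff (Q : ℂ → EReal) (p : ℂ) : ℂ :=
  let B := fderiv ℝ (fderiv ℝ fun z => (Q z).toReal) p
  ⟨(B 1 1 - B Complex.I Complex.I) / 4, -(B 1 Complex.I + B Complex.I 1) / 4⟩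

theorem fderiv_eq_re_linCoeff (Q : ℂ → EReal) (p h : ℂ) :
    fderiv ℝ (fun z => (Q z).toReal) p h = (linCoeff Q p * h).re := by
  have hh : h = h.re • (1 : ℂ) + h.im • Complex.I := by
    simp [Complex.re_add_im]
  conv_lhs => rw [hh, map_add, map_smul, map_smul]
  simp [linCoeff]
  ring

theorem lap_eq_fderiv (Q : ℂ → EReal) (p : ℂ) :
    lap Q p = (fderiv ℝ (fderiv ℝ fun z => (Q z).toReal) p 1 1 +
      fderiv ℝ (fderiv ℝ fun z => (Q z).toReal) p Complex.I Complex.I) / 4 := by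
  rw [lap, InnerProductSpace.laplacian_eq_iteratedFDeriv_complexPlane]
  simp only [iteratedFDeriv_two_apply]
  simp
  ring

theorem continuousOn_lap {Q : ℂ → EReal} {U : Set ℂ} (hU : IsOpen U)
    (hf : ContDiffOn ℝ 2 (fun z => (Q z).toReal) U) : ContinuousOn (lap Q) U := by
  have h := (hf.fderiv_of_isOpen hU (m := 1) (by norm_num)).continuousOn_fderiv_of_isOpen hU
    (by norm_num)
  have h2 : ∀ u : ℂ, ContinuousOn
      (fun p => fderiv ℝ (fderiv ℝ fun z => (Q z).toReal) p u u) U := fun u =>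
    (h.clm_apply continuousOn_const).clm_apply continuousOn_const
  refine (((h2 1).add (h2 Complex.I)).div_const 4).congr fun p _ => ?_
  exact lap_eq_fderiv Q p

theorem fderiv_fderiv_eq_quadCoeff (Q : ℂ → EReal) (p h : ℂ) :
    fderiv ℝ (fderiv ℝ fun z => (Q z).toReal) p h h / 2 =
      lap Q p * ‖h‖ ^ 2 + (quadCoeff Q p * h ^ 2).re := by
  have hh : h = h.re • (1 : ℂ) + h.im • Complex.I := by
    simp [Complex.re_add_im]
  rw [lap_eq_fderiv, ← Complex.normSq_eq_norm_sq, Complex.normSq_apply, quadCoeff]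
  set B := fderiv ℝ (fderiv ℝ fun z => (Q z).toReal) p
  conv_lhs => rw [hh]
  simp only [map_add, map_smul, add_apply, smul_apply, smul_eq_mul, sq, Complex.mul_re,
    Complex.mul_im]
  ring

/-- Compact support is part of the minimization class, and if there is no minimizer the support of
the zero measure is empty. -/
theorem isCompact_droplet (Q : ℂ → EReal) : IsCompact (droplet Q) := by
  rw [droplet, equilibriumMeasure]
  split_ifs with h
  · exact h.choose_spec.1.2
  · simp

/-! ### The rescaled kernels -/

/-- The displacement `e^{iθ} z / √(n ΔQ(p))` of the point with rescaled coordinate `z`. -/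
def displacement (Q : ℂ → EReal) (n : ℕ) (p : ℂ) (θ : ℝ) (z : ℂ) : ℂ :=
  Complex.exp (θ * Complex.I) * z / (scale Q n p : ℂ)

/-- Half of `n` times the polynomial whose real part is the harmonic part of the second-order
expansion of `Q` at `p`, in the rescaled coordinate. -/
def phasePoly (Q : ℂ → EReal) (n : ℕ) (p : ℂ) (θ : ℝ) (z : ℂ) : ℂ :=
  n * (linCoeff Q p * displacement Q n p θ z + quadCoeff Q p * displacement Q n p θ z ^ 2) / 2

/-- The cocycle that removes the harmonic part of the potential. -/
def phaseCocycle (Q : ℂ → EReal) (n : ℕ) (p : ℂ) (θ : ℝ) (z w : ℂ) : ℂ :=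
  Complex.exp (-((phasePoly Q n p θ z).im * Complex.I)) *
    Complex.exp ((phasePoly Q n p θ w).im * Complex.I)

/-- The weight `e^{-nQ/2}` in the rescaled coordinate, with the harmonic part removed. -/
def localWeight (Q : ℂ → EReal) (n : ℕ) (p : ℂ) (θ : ℝ) (z : ℂ) : ℝ :=
  Real.exp (n * (Q p).toReal / 2 + (phasePoly Q n p θ z).re) *
    weight Q n (p + displacement Q n p θ z)

/-- The Hermitian-entire factor of the rescaled kernel. -/
def entireFactor (Q : ℂ → EReal) (n : ℕ) (p : ℂ) (θ : ℝ) (z w : ℂ) : ℂ :=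
  Complex.exp (-(phasePoly Q n p θ z) - conj (phasePoly Q n p θ w) - n * (Q p).toReal) *
    (∑ i : Fin n, ∑ j : Fin n, (p + displacement Q n p θ z) ^ (i : ℕ) * (gram Q n)⁻¹ i j *
      conj (p + displacement Q n p θ w) ^ (j : ℕ)) / ((n * lap Q p : ℝ) : ℂ)

section

variable {Q : ℂ → EReal} {n : ℕ} {p : ℂ} {θ : ℝ}

theorem differentiable_displacement : Differentiable ℂ (displacement Q n p θ) := by
  unfold displacement
  fun_prop

theorem differentiable_phasePoly : Differentiable ℂ (phasePoly Q n p θ) := by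
  have := differentiable_displacement (Q := Q) (n := n) (p := p) (θ := θ)
  unfold phasePoly
  fun_prop

theorem isCocycle_phaseCocycle : IsCocycle (phaseCocycle Q n p θ) := by
  have hc : Continuous (phasePoly Q n p θ) := differentiable_phasePoly.continuous
  refine ⟨⟨?_, fun z w => ?_⟩, fun m z => ?_⟩
  · unfold phaseCocycle
    fun_prop
  · simp only [phaseCocycle, map_mul, ← Complex.exp_conj, map_neg, Complex.conj_ofReal,
      Complex.conj_I, mul_neg, neg_neg]
    rw [mul_comm]
  · simp only [phaseCocycle, Finset.prod_mul_distrib]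
    -- After a cyclic shift, the factors depending on the second arguments are the inverses of those
    -- depending on the first.
    have h := Equiv.prod_comp (Equiv.addRight (1 : Fin (m + 1)))
      (fun i => Complex.exp ((phasePoly Q n p θ (z i)).im * Complex.I))
    simp only [Equiv.coe_addRight] at h
    rw [h, ← Finset.prod_mul_distrib]
    simp [← Complex.exp_add]

theorem norm_phaseCocycle (z w : ℂ) : ‖phaseCocycle Q n p θ z w‖ = 1 := by
  rw [phaseCocycle, norm_mul, ← neg_mul, ← Complex.ofReal_neg, Complex.norm_exp_ofReal_mul_I,
    Complex.norm_exp_ofReal_mul_I, one_mul]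

theorem phaseCocycle_self (z : ℂ) : phaseCocycle Q n p θ z z = 1 := by
  rw [phaseCocycle, ← Complex.exp_add, neg_add_cancel, Complex.exp_zero]

theorem differentiable_entireFactor :
    Differentiable ℂ fun x : ℂ × ℂ => entireFactor Q n p θ x.1 (conj x.2) := by
  have hd := differentiable_displacement (Q := Q) (n := n) (p := p) (θ := θ)
  have hp := differentiable_phasePoly (Q := Q) (n := n) (p := p) (θ := θ)
  -- The second variable enters through `conj (f (conj w))`, which is again holomorphic.
  have hconj : ∀ {f : ℂ → ℂ}, Differentiable ℂ f → Differentiable ℂ fun w => conj (f (conj w)) :=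
    fun hf w => by
      have h := (hf (conj w)).star_star
      rwa [show star (conj w) = w from star_star w] at h
  have hd' := (hconj hd).comp (differentiable_snd (𝕜 := ℂ) (E := ℂ) (F := ℂ))
  have hp' := (hconj hp).comp (differentiable_snd (𝕜 := ℂ) (E := ℂ) (F := ℂ))
  simp only [Function.comp_def] at hd' hp'
  unfold entireFactor
  simp only [map_add, div_eq_mul_inv]
  refine Differentiable.mul_const (Differentiable.fun_mul ?_ ?_) _
  · fun_prop
  exact Differentiable.fun_sum fun i _ => Differentiable.fun_sum fun j _ => by fun_prop

theorem scale_sq (hl : 0 < lap Q p) : scale Q n p ^ 2 = n * lap Q p :=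
  Real.sq_sqrt (by positivity)

theorem rescaledKernel_eq (hQ : IsAdmissible Q) (hG : (gram Q n).PosDef) (z w : ℂ) :
    rescaledKernel Q n p θ z w = gramKernel Q n (p + displacement Q n p θ z)
      (p + displacement Q n p θ w) / ((n * lap Q p : ℝ) : ℂ) := by
  rw [rescaledKernel, kernel_eq_gramKernel hQ hG]
  rfl

/-- Writing `P` for the phase polynomial, `-P(z) - conj P(w) + Re P(z) + Re P(w) = -i Im P(z) + i Im
P(w)`, while the two halves of `n Q(p)` cancel the term `-n Q(p)` in the entire factor. -/
theorem phaseCocycle_mul_rescaledKernel (hQ : IsAdmissible Q) (hG : (gram Q n).PosDef) (z w : ℂ) :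
    phaseCocycle Q n p θ z w * rescaledKernel Q n p θ z w =
      entireFactor Q n p θ z w * localWeight Q n p θ z * localWeight Q n p θ w := by
  rw [rescaledKernel_eq hQ hG]
  have hk : gramKernel Q n (p + displacement Q n p θ z) (p + displacement Q n p θ w) =
      (∑ i : Fin n, ∑ j : Fin n, (p + displacement Q n p θ z) ^ (i : ℕ) * (gram Q n)⁻¹ i j *
        conj (p + displacement Q n p θ w) ^ (j : ℕ)) *
      (weight Q n (p + displacement Q n p θ z) * weight Q n (p + displacement Q n p θ w)) := by
    simp only [gramKernel, weightedMonomial, Finset.sum_mul, map_mul, map_pow,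
      Complex.conj_ofReal]
    refine Finset.sum_congr rfl fun i _ => Finset.sum_congr rfl fun j _ => ?_
    ring
  have he : phaseCocycle Q n p θ z w =
      Complex.exp (-(phasePoly Q n p θ z) - conj (phasePoly Q n p θ w) - n * (Q p).toReal) *
        (Real.exp (n * (Q p).toReal / 2 + (phasePoly Q n p θ z).re) : ℂ) *
        (Real.exp (n * (Q p).toReal / 2 + (phasePoly Q n p θ w).re) : ℂ) := by
    rw [phaseCocycle, Complex.ofReal_exp, Complex.ofReal_exp, ← Complex.exp_add,
      ← Complex.exp_add, ← Complex.exp_add]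
    congr 1
    have h1 := Complex.re_add_im (phasePoly Q n p θ z)
    have h3 : conj (phasePoly Q n p θ w) =
        (phasePoly Q n p θ w).re - (phasePoly Q n p θ w).im * Complex.I := by
      apply Complex.ext <;> simp
    rw [h3]
    conv_rhs => rw [← h1]
    simp only [Complex.add_re, Complex.mul_re, Complex.I_re, Complex.I_im, Complex.ofReal_re,
      Complex.ofReal_im]
    push_cast
    ring
  rw [hk, he, entireFactor, localWeight, localWeight]
  push_cast
  ring

theorem measurable_rescaledKernel (hQ : IsAdmissible Q) (hG : (gram Q n).PosDef) :
    Measurable fun x : ℂ × ℂ => rescaledKernel Q n p θ x.1 x.2 := by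
  simp only [rescaledKernel_eq hQ hG]
  have hd : Measurable (displacement Q n p θ) := differentiable_displacement.continuous.measurable
  have h := (isProjectionKernel_gramKernel hQ hG).meas
  exact (h.comp (f := fun x : ℂ × ℂ => (p + displacement Q n p θ x.1, p + displacement Q n p θ x.2))
    (by fun_prop)).div_const _

theorem rescaledKernel_hermitian (hQ : IsAdmissible Q) (hG : (gram Q n).PosDef) (z w : ℂ) :
    rescaledKernel Q n p θ z w = conj (rescaledKernel Q n p θ w z) := by
  rw [rescaledKernel_eq hQ hG, rescaledKernel_eq hQ hG, map_div₀, Complex.conj_ofReal,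
    ← gramKernel_hermitian hG]

theorem isCorrelationKernel_rescaledKernel (hQ : IsAdmissible Q) (hG : (gram Q n).PosDef)
    (hn : 1 ≤ n) (hl : 0 < lap Q p) :
    IsCorrelationKernel (rescaledGibbs Q n p θ) (rescaledKernel Q n p θ) := by
  have hs : 0 < scale Q n p := Real.sqrt_pos.2 (by positivity)
  have hs' : (scale Q n p : ℂ) ≠ 0 := by exact_mod_cast hs.ne'
  have hexp : Complex.exp (θ * Complex.I) * Complex.exp (-(θ * Complex.I)) = 1 := by
    rw [← Complex.exp_add, add_neg_cancel, Complex.exp_zero]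
  refine (isCorrelationKernel_gibbs hQ hG).affine
    (mul_ne_zero (Complex.exp_ne_zero _) hs') p (fun ζ η => ?_) (measurable_rescaledKernel hQ hG)
  have hdis : ∀ ζ, p + displacement Q n p θ
      (Complex.exp (-(θ * Complex.I)) * (scale Q n p : ℂ) * (ζ - p)) = ζ := by
    intro ζ
    have : displacement Q n p θ
        (Complex.exp (-(θ * Complex.I)) * (scale Q n p : ℂ) * (ζ - p)) =
        (Complex.exp (θ * Complex.I) * Complex.exp (-(θ * Complex.I))) * (ζ - p) := by
      rw [displacement]
      field_simp
    rw [this, hexp]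
    ring
  rw [rescaledKernel_eq hQ hG, hdis, hdis, norm_mul, ← neg_mul, ← Complex.ofReal_neg,
    Complex.norm_exp_ofReal_mul_I, Complex.norm_real, one_mul, Real.norm_eq_abs, sq_abs,
    scale_sq hl]

/-- The reproducing property at a diagonal point gives the unscaled identity. The Jacobian `nΔQ(p)`
against the normalization `(nΔQ(p))⁻²` leaves the single factor of the rescaled kernel. -/
theorem mass_rescaledKernel (hQ : IsAdmissible Q) (hG : (gram Q n).PosDef) (hl : 0 < lap Q p)
    (z : ℂ) :
    Integrable (fun w => ‖rescaledKernel Q n p θ z w‖ ^ 2) dA ∧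
    ∫ w, ‖rescaledKernel Q n p θ z w‖ ^ 2 ∂dA = (rescaledKernel Q n p θ z z).re := by
  -- For `n = 0` the kernel is divided by `0`, so both sides vanish.
  rcases Nat.eq_zero_or_pos n with rfl | hn
  · simp [rescaledKernel]
  have hK := isProjectionKernel_gramKernel hQ hG
  have hs : 0 < scale Q n p := Real.sqrt_pos.2 (by positivity)
  have hs' : (scale Q n p : ℂ) ≠ 0 := by exact_mod_cast hs.ne'
  have hN : 0 < n * lap Q p := by positivity
  set ζ := p + displacement Q n p θ z with hζ
  set a : ℂ := Complex.exp (θ * Complex.I) / (scale Q n p : ℂ) with ha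
  have ha0 : a ≠ 0 := div_ne_zero (Complex.exp_ne_zero _) hs'
  have hna : (‖a‖ ^ 2)⁻¹ = n * lap Q p := by
    rw [ha, norm_div, Complex.norm_exp_ofReal_mul_I, Complex.norm_real,
      Real.norm_of_nonneg hs.le, div_pow, scale_sq hl]
    simp
  have hmap := map_affine_dA ha0 (-(p / a))
  have haff : ∀ w, a * (w - -(p / a)) = p + displacement Q n p θ w := by
    intro w
    rw [displacement, sub_neg_eq_add, mul_add, mul_div_cancel₀ _ ha0, ha]
    ring
  simp only [haff, hna] at hmap
  have hmd : Measurable fun w => p + displacement Q n p θ w :=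
    (differentiable_displacement.continuous.measurable).const_add p
  have hsq : ∀ u, ((‖gramKernel Q n ζ u‖ ^ 2 : ℝ) : ℂ) = gramKernel Q n ζ u * gramKernel Q n u ζ := by
    intro u
    rw [gramKernel_hermitian hG u ζ, Complex.mul_conj', Complex.ofReal_pow]
  have hI : Integrable (fun u => ‖gramKernel Q n ζ u‖ ^ 2) dA := by
    have h := (hK.integrable ζ ζ).norm
    simp only [← hsq, Complex.norm_real, Real.norm_of_nonneg (sq_nonneg _)] at h
    exact h
  have hmass : ((∫ u, ‖gramKernel Q n ζ u‖ ^ 2 ∂dA : ℝ) : ℂ) = gramKernel Q n ζ ζ := by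
    rw [← hK.reproducing ζ ζ, ← integral_complex_ofReal]
    simp only [hsq]
  have hI' : Integrable (fun u => ‖gramKernel Q n ζ u‖ ^ 2)
      (dA.map fun w => p + displacement Q n p θ w) := by
    rw [hmap]
    exact hI.smul_measure ENNReal.ofReal_ne_top
  have hnorm : ∀ w, ‖rescaledKernel Q n p θ z w‖ ^ 2 =
      ‖gramKernel Q n ζ (p + displacement Q n p θ w)‖ ^ 2 * ((n * lap Q p) ^ 2)⁻¹ := by
    intro w
    rw [rescaledKernel_eq hQ hG, norm_div, Complex.norm_real, Real.norm_of_nonneg hN.le, div_pow,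
      div_eq_mul_inv]
  simp only [hnorm]
  refine ⟨(hI'.comp_measurable hmd).mul_const _, ?_⟩
  rw [integral_mul_const, ← integral_map hmd.aemeasurable hI'.1, hmap, integral_smul_measure,
    rescaledKernel_eq hQ hG, ← hζ, ← hmass, ← Complex.ofReal_div, Complex.ofReal_re,
    ENNReal.toReal_ofReal hN.le, smul_eq_mul]
  field_simp

end

/-- Under rescaling `nΔQ(p)|h|² = |z|²`, and the phase polynomial cancels the harmonic terms of the
expansion. What remains beside the Gaussian is the exponential of `-n/2` times the Taylor remainder,
which is `o(|h|²)` with `|h|² = O(1/n)`, uniformly in the base point. -/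
theorem tendsto_localWeight {Q : ℂ → EReal} {U : Set ℂ} (hU : IsOpen U)
    (hSU : droplet Q ⊆ U) (hfin : ∀ z ∈ U, Q z ≠ ⊤)
    (hf : ContDiffOn ℝ 2 (fun z => (Q z).toReal) U) (hlap : ∀ z ∈ U, 0 < lap Q z)
    {p : ℕ → ℂ} (hp : ∀ n, p n ∈ droplet Q) (θ : ℕ → ℝ) (R : ℝ) :
    TendstoUniformlyOn (fun n => localWeight Q n (p n) (θ n))
      (fun z => Real.exp (-‖z‖ ^ 2 / 2)) atTop (Metric.closedBall 0 R) := by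
  obtain ⟨p₀, hp₀, hmin⟩ := (isCompact_droplet Q).exists_isMinOn ⟨p 0, hp 0⟩
    ((continuousOn_lap hU hf).mono hSU)
  set m := lap Q p₀ with hm
  have hm0 : 0 < m := hlap p₀ (hSU hp₀)
  have hmle : ∀ n, m ≤ lap Q (p n) := fun n => hmin (hp n)
  rw [Metric.tendstoUniformlyOn_iff]
  intro ε hε
  -- The bound `1` keeps the exponent in the range where `|eˣ - 1| ≤ 2|x|`; `ε / 4` makes the final
  -- error less than `ε`.
  set κ := min 1 (ε / 4) with hκ
  have hκ0 : 0 < κ := lt_min one_pos (by linarith)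
  -- The tolerance is chosen so that `n` times the remainder is at most `κ (m / ΔQ(p)) |z|² / (R² +
  -- 1) ≤ κ`.
  obtain ⟨δ, hδ, htaylor⟩ := exists_uniform_taylor_two hU hf (isCompact_droplet Q) hSU
    (ε := κ * m / (R ^ 2 + 1)) (by positivity)
  -- Beyond `N` the displacement satisfies `|h|² ≤ R² / (n m) ≤ δ²`.
  obtain ⟨N, hN⟩ := exists_nat_gt (R ^ 2 / (δ ^ 2 * m))
  filter_upwards [eventually_ge_atTop (N + 1)] with n hn z hz
  have hz' : ‖z‖ ^ 2 ≤ R ^ 2 :=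
    pow_le_pow_left₀ (norm_nonneg z) (by simpa using hz) 2
  have hnpos : (0 : ℝ) < n := by
    have : 0 < n := by omega
    exact_mod_cast this
  have hnN : (N : ℝ) ≤ n := by
    have : N ≤ n := by omega
    exact_mod_cast this
  set l := lap Q (p n) with hl
  have hl0 : 0 < l := hm0.trans_le (hmle n)
  set h := displacement Q n (p n) (θ n) z with hh
  have hs : 0 < scale Q n (p n) := Real.sqrt_pos.2 (by positivity)
  have hnorm : ‖h‖ ^ 2 = ‖z‖ ^ 2 / (n * l) := by
    rw [hh, displacement, norm_div, norm_mul, Complex.norm_exp_ofReal_mul_I, one_mul,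
      Complex.norm_real, Real.norm_of_nonneg hs.le, div_pow, scale_sq hl0]
  have hhδ : ‖h‖ ≤ δ := by
    refine abs_le_of_sq_le_sq' ?_ hδ.le |>.2
    rw [hnorm, div_le_iff₀ (by positivity)]
    have h1 : R ^ 2 < n * (δ ^ 2 * m) := by
      rw [← div_lt_iff₀ (by positivity)]
      exact hN.trans_le hnN
    have h2 : n * (δ ^ 2 * m) ≤ δ ^ 2 * (n * l) := by
      have := mul_le_mul_of_nonneg_left (hmle n) (by positivity : 0 ≤ n * δ ^ 2)
      linarith
    linarith
  obtain ⟨hmemU, herr⟩ := htaylor (p n) (hp n) h hhδ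
  rw [fderiv_eq_re_linCoeff, fderiv_fderiv_eq_quadCoeff] at herr
  set err := (Q (p n + h)).toReal - (Q (p n)).toReal - (linCoeff Q (p n) * h).re -
    (l * ‖h‖ ^ 2 + (quadCoeff Q (p n) * h ^ 2).re) with herr_def
  have hx : |-(n * err / 2)| ≤ κ / 2 := by
    rw [abs_neg, abs_div, abs_mul, abs_of_pos hnpos, abs_two]
    have h1 : n * |err| ≤ κ := by
      calc n * |err| ≤ n * (κ * m / (R ^ 2 + 1) * ‖h‖ ^ 2) := by gcongr
        _ = κ * (m / l) * (‖z‖ ^ 2 / (R ^ 2 + 1)) := by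
            rw [hnorm]
            field_simp
        _ ≤ κ * 1 * 1 := by
            gcongr
            · exact (div_le_one hl0).2 (hmle n)
            · exact (div_le_one (by positivity)).2 (by linarith)
        _ = κ := by ring
    linarith
  have hE : localWeight Q n (p n) (θ n) z =
      Real.exp (-‖z‖ ^ 2 / 2) * Real.exp (-(n * err / 2)) := by
    have h2 : (phasePoly Q n (p n) (θ n) z).re =
        n * ((linCoeff Q (p n) * h).re + (quadCoeff Q (p n) * h ^ 2).re) / 2 := by
      have : phasePoly Q n (p n) (θ n) z = ((n / 2 : ℝ) : ℂ) *
          (linCoeff Q (p n) * h + quadCoeff Q (p n) * h ^ 2) := by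
        rw [phasePoly, ← hh]
        push_cast
        ring
      rw [this, Complex.re_ofReal_mul, Complex.add_re]
      ring
    have h3 : n * (l * ‖h‖ ^ 2) = ‖z‖ ^ 2 := by
      rw [hnorm]
      field_simp
    rw [localWeight, ← hh, weight, if_neg (hfin _ hmemU), ← Real.exp_add, ← Real.exp_add, h2]
    congr 1
    rw [herr_def, ← h3]
    ring
  have hexp : |Real.exp (-(n * err / 2)) - 1| ≤ κ := by
    refine (Real.abs_exp_sub_one_le (hx.trans ?_)).trans (by linarith)
    linarith [min_le_left 1 (ε / 4)]
  have hle1 : Real.exp (-‖z‖ ^ 2 / 2) ≤ 1 := by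
    rw [Real.exp_le_one_iff]
    have := sq_nonneg ‖z‖
    linarith
  rw [hE, Real.dist_eq, abs_sub_comm]
  calc |Real.exp (-‖z‖ ^ 2 / 2) * Real.exp (-(n * err / 2)) - Real.exp (-‖z‖ ^ 2 / 2)|
      = Real.exp (-‖z‖ ^ 2 / 2) * |Real.exp (-(n * err / 2)) - 1| := by
        rw [← abs_of_pos (Real.exp_pos (-‖z‖ ^ 2 / 2)), ← abs_mul,
          abs_of_pos (Real.exp_pos (-‖z‖ ^ 2 / 2))]
        ring_nf
    _ ≤ 1 * κ := mul_le_mul hle1 hexp (abs_nonneg _) zero_le_one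
    _ < ε := by linarith [min_le_right 1 (ε / 4)]

/-- The rescaled kernels, multiplied by the phase cocycles, factor through Hermitian-entire
functions. -/
theorem isGaussianFactorization_rescaledKernel {Q : ℂ → EReal} (hQ : IsAdmissible Q) {U : Set ℂ}
    (hU : IsOpen U) (hSU : droplet Q ⊆ U) (hfin : ∀ z ∈ U, Q z ≠ ⊤)
    (hf : ContDiffOn ℝ 2 (fun z => (Q z).toReal) U) (hlap : ∀ z ∈ U, 0 < lap Q z)
    {p : ℕ → ℂ} (hp : ∀ n, p n ∈ droplet Q) (θ : ℕ → ℝ) :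
    IsGaussianFactorization
      (fun n z w => phaseCocycle Q n (p n) (θ n) z w * rescaledKernel Q n (p n) (θ n) z w)
      (fun n => entireFactor Q n (p n) (θ n)) (fun n => localWeight Q n (p n) (θ n)) := by
  have hG : ∀ n, (gram Q n).PosDef := fun n => gram_posDef hQ hU ⟨p 0, hSU (hp 0)⟩ hfin
  have hl : ∀ n, 0 < lap Q (p n) := fun n => hlap _ (hSU (hp n))
  constructor
  · exact fun n => phaseCocycle_mul_rescaledKernel hQ (hG n)
  · exact fun n => differentiable_entireFactor
  · intro n z w
    rw [map_mul, ← isCocycle_phaseCocycle.1.2, ← rescaledKernel_hermitian hQ (hG n)]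
  · intro n z
    simpa only [norm_mul, norm_phaseCocycle, one_mul] using
      (mass_rescaledKernel hQ (hG n) (hl n) z).1
  · intro n z
    simpa only [norm_mul, norm_phaseCocycle, phaseCocycle_self, one_mul] using
      (mass_rescaledKernel hQ (hG n) (hl n) z).2
  · exact tendsto_localWeight hU hSU hfin hf hlap hp θ

end RandomNormal

end

theorem theorem1p1 (Q : ℂ → EReal) (hQ : RandomNormal.IsAdmissible Q)
    (U : Set ℂ) (hU : IsOpen U) (hSU : RandomNormal.droplet Q ⊆ U)
    (hfin : ∀ z ∈ U, Q z ≠ ⊤)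
    (han : AnalyticOnNhd ℝ (fun z => (Q z).toReal) U)
    (hlap : ∀ z ∈ U, 0 < RandomNormal.lap Q z)
    (p : ℕ → ℂ) (hp : ∀ n, p n ∈ RandomNormal.droplet Q) (θ : ℕ → ℝ) :
    (∀ n : ℕ, 1 ≤ n →
      RandomNormal.IsCorrelationKernel (RandomNormal.rescaledGibbs Q n (p n) (θ n))
        (RandomNormal.rescaledKernel Q n (p n) (θ n))) ∧
    ∃ c : ℕ → ℂ → ℂ → ℂ,
      (∀ n, RandomNormal.IsCocycle (c n)) ∧
      (∀ φ : ℕ → ℕ, StrictMono φ →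
        ∃ ψ : ℕ → ℕ, StrictMono ψ ∧ ∃ K : ℂ → ℂ → ℂ,
          RandomNormal.TendstoOnCompacts
            (fun j z w => c (φ (ψ j)) z w *
              RandomNormal.rescaledKernel Q (φ (ψ j)) (p (φ (ψ j))) (θ (φ (ψ j))) z w) K) ∧
      (∀ φ : ℕ → ℕ, StrictMono φ → ∀ K : ℂ → ℂ → ℂ,
        RandomNormal.TendstoOnCompacts
          (fun j z w => c (φ j) z w *
            RandomNormal.rescaledKernel Q (φ j) (p (φ j)) (θ (φ j)) z w) K →
        ∃ Ψ : ℂ → ℂ → ℂ, RandomNormal.IsHermitianEntire Ψ ∧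
          (∀ z w, K z w = RandomNormal.ginibre z w * Ψ z w) ∧
          RandomNormal.MassOneInequality Ψ) := by
  have hf : ContDiffOn ℝ 2 (fun z => (Q z).toReal) U := han.contDiffOn hU.uniqueDiffOn
  -- The factorization passes to subsequences, so compactness and the form of the limits both follow
  -- by applying the abstract results along `φ`.
  have hfac := RandomNormal.isGaussianFactorization_rescaledKernel hQ hU hSU hfin hf hlap hp θ
  refine ⟨fun n hn => RandomNormal.isCorrelationKernel_rescaledKernel hQ
      (RandomNormal.gram_posDef hQ hU ⟨p 0, hSU (hp 0)⟩ hfin) hn (hlap _ (hSU (hp n))),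
    fun n => RandomNormal.phaseCocycle Q n (p n) (θ n),
    fun n => RandomNormal.isCocycle_phaseCocycle, fun φ hφ => ?_, fun φ hφ K hK => ?_⟩
  · obtain ⟨ψ, hψ, g, -, hg⟩ := (hfac.subseq hφ).exists_subseq
    exact ⟨ψ, hψ, _, hg⟩
  · exact (hfac.subseq hφ).limit_eq hK
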